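/- Let $N\ge 1$ and let $\mathbb{R}^N_\infty=\mathbb{R}^N\cup\{\infty\}$ be the one-point compactification of $\mathbb{R}^N$. A sphere in $\mathbb{R}^N_\infty$ is either an $(N-1)$-dimensional Euclidean sphere in $\mathbb{R}^N$ or an $(N-1)$-dimensional Euclidean plane in $\mathbb{R}^N$ with the point $\infty$ attached; the inversion in it is the Euclidean inversion (exchanging the centre and $\infty$), respectively the Euclidean reflection (fixing $\infty$). The Möbius transformations of $\mathbb{R}^N_\infty$ are the elements of the group generated by inversions in spheres. An open ball $B$ is one of the two connected components of the complement of a sphere $\partial B$, and $\widehat{B}$ denotes the other component. The signed inversive distance $[B_1,B_2]$ of two open balls is determined by the following: if $B_1,B_2$ are Euclidean balls with centres $c_1,c_2$ and radii $r_1,r_2$, then $$[B_1,B_2]=\frac{r_1^2+r_2^2-|c_1-c_2|^2}{2r_1r_2};$$ $[\widehat{B_1},B_2]=[B_1,\widehat{B_2}]=-[B_1,B_2]$; and for arbitrary open balls $[B_1,B_2]=[g(B_1),g(B_2)]$, where $g$ is any Möbius transformation for which $g(\partial B_1)$ and $g(\partial B_2)$ are Euclidean spheres. (In particular $[B,B]=1$.)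 **Theorem.** Let $\{B_\alpha:\alpha\in\mathcal{A}\}$ and $\{B'_\alpha:\alpha\in\mathcal{A}\}$ be two collections of open balls in $\mathbb{R}^N_\infty$, indexed by the same set, and suppose that $\bigcap_{\alpha\in\mathcal{A}}\partial B_\alpha=\emptyset$. Then there is a Möbius transformation $f$ such that either $f(B_\alpha)=B'_\alpha$ for each $\alpha\in\mathcal{A}$, or else $f(\widehat{B_\alpha})=B'_\alpha$ for each $\alpha\in\mathcal{A}$, if and only if $[B_\alpha,B_\beta]=[B'_\alpha,B'_\beta]$ for all $\alpha,\beta\in\mathcal{A}$. -/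

import Mathlib

open scoped OnePoint

noncomputable section

namespace InversiveGeometry

/-- The one point extension of `ℝ^N`, with its usual (one point compactification) topology. -/
abbrev ExtSpace (N : ℕ) : Type := OnePoint (EuclideanSpace ℝ (Fin N))

/-- The `(N-1)`-dimensional Euclidean plane in `ℝ^N` through `p` with normal vector `n`
(meaningful for `n ≠ 0`). -/
abbrev euclideanPlane {N : ℕ} (p n : EuclideanSpace ℝ (Fin N)) :
    AffineSubspace ℝ (EuclideanSpace ℝ (Fin N)) :=
  AffineSubspace.mk' p (Submodule.span ℝ {n})ᗮ

/-- A sphere in the extended space: an `(N-1)`-dimensional Euclidean sphere, or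
an `(N-1)`-dimensional Euclidean plane with the point `∞` attached. -/
def IsSphere {N : ℕ} (S : Set (ExtSpace N)) : Prop :=
  (∃ (c : EuclideanSpace ℝ (Fin N)) (r : ℝ), 0 < r ∧
      S = (fun x : EuclideanSpace ℝ (Fin N) => (x : ExtSpace N)) '' Metric.sphere c r) ∨
  (∃ p n : EuclideanSpace ℝ (Fin N), n ≠ 0 ∧
      S = insert ∞ ((fun x : EuclideanSpace ℝ (Fin N) => (x : ExtSpace N)) ''
        (euclideanPlane p n : Set (EuclideanSpace ℝ (Fin N)))))

/-- An open ball: one of the connected components of the complement of a sphere. -/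
def IsOpenBall {N : ℕ} (B : Set (ExtSpace N)) : Prop :=
  ∃ S : Set (ExtSpace N), IsSphere S ∧ ∃ x ∈ Sᶜ, B = connectedComponentIn Sᶜ x

/-- The ball complementary to an open ball `B`, that is, the other component of the complement
of the sphere `∂B`: what remains when `B` and `∂B` are removed. -/
def hat {N : ℕ} (B : Set (ExtSpace N)) : Set (ExtSpace N) := (B ∪ frontier B)ᶜ

open Classical in
/-- The inversion of the extended space in the Euclidean sphere with centre `c` and radius `r`, as
a function. It exchanges `c` and `∞`. -/
def sphereInversionFun {N : ℕ} (c : EuclideanSpace ℝ (Fin N)) (r : ℝ) (x : ExtSpace N) :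
    ExtSpace N :=
  x.elim (c : ExtSpace N)
    (fun y => if y = c then ∞ else ((EuclideanGeometry.inversion c r y : EuclideanSpace ℝ (Fin N)) : ExtSpace N))

theorem sphereInversionFun_involutive {N : ℕ} (c : EuclideanSpace ℝ (Fin N)) {r : ℝ}
    (hr : 0 < r) : Function.Involutive (sphereInversionFun c r) := by
  intro x
  induction x using OnePoint.rec with
  | infty => simp [sphereInversionFun]
  | coe y =>
    by_cases h : y = c
    · simp [sphereInversionFun, h]
    · have h2 : EuclideanGeometry.inversion c r y ≠ c := by
        rw [Ne, EuclideanGeometry.inversion_eq_center hr.ne']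
        exact h
      simp [sphereInversionFun, h, h2, EuclideanGeometry.inversion_inversion c hr.ne']

/-- The inversion of the extended space in the Euclidean sphere with centre `c` and
radius `r > 0`. -/
def sphereInversion {N : ℕ} (c : EuclideanSpace ℝ (Fin N)) (r : ℝ) (hr : 0 < r) :
    Equiv.Perm (ExtSpace N) :=
  (sphereInversionFun_involutive c hr).toPerm

/-- The Euclidean reflection in the plane through `p` with normal vector `n`, extended by
fixing `∞`, as a function. -/
def planeReflectionFun {N : ℕ} (p n : EuclideanSpace ℝ (Fin N)) : ExtSpace N → ExtSpace N :=
  OnePoint.map (EuclideanGeometry.reflection (euclideanPlane p n))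

theorem planeReflectionFun_involutive {N : ℕ} (p n : EuclideanSpace ℝ (Fin N)) :
    Function.Involutive (planeReflectionFun p n) := by
  intro x
  induction x using OnePoint.rec with
  | infty => rfl
  | coe y => simp [planeReflectionFun]

/-- The inversion of the extended space in the plane through `p` with normal vector `n`. -/
def planeReflection {N : ℕ} (p n : EuclideanSpace ℝ (Fin N)) : Equiv.Perm (ExtSpace N) :=
  (planeReflectionFun_involutive p n).toPerm

/-- Inversions in spheres of the extended space. -/
def IsInversion {N : ℕ} (σ : Equiv.Perm (ExtSpace N)) : Prop :=
  (∃ (c : EuclideanSpace ℝ (Fin N)) (r : ℝ) (hr : 0 < r), σ = sphereInversion c r hr) ∨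
  (∃ p n : EuclideanSpace ℝ (Fin N), n ≠ 0 ∧ σ = planeReflection p n)

/-- The group of Möbius transformations of the extended space: the group generated by the
inversions in spheres. -/
def mobiusGroup (N : ℕ) : Subgroup (Equiv.Perm (ExtSpace N)) :=
  Subgroup.closure {σ | IsInversion σ}

/-- The open Euclidean ball with centre `c` and radius `r`, as a subset of the extended space. -/
def euclideanBall {N : ℕ} (c : EuclideanSpace ℝ (Fin N)) (r : ℝ) : Set (ExtSpace N) :=
  (fun x : EuclideanSpace ℝ (Fin N) => (x : ExtSpace N)) '' Metric.ball c r

/-- `B` is a side of the Euclidean sphere with centre `c` and radius `r`: the inside when `ε = 1`,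
the outside (which contains `∞`) when `ε = -1`. -/
def IsSideOfEuclideanSphere {N : ℕ} (B : Set (ExtSpace N)) (c : EuclideanSpace ℝ (Fin N)) (r : ℝ)
    (ε : ℝ) : Prop :=
  (ε = 1 ∧ B = euclideanBall c r) ∨ (ε = -1 ∧ B = hat (euclideanBall c r))

/-- `d` is a value of the signed inversive distance of `B₁` and `B₂`. For two Euclidean
balls the value is `(r₁² + r₂² - |c₁ - c₂|²) / (2 r₁ r₂)`; replacing one ball by its complementary
ball changes the sign; and two arbitrary balls are first moved by a Möbius transformation so
that their boundaries are Euclidean spheres. -/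
def HasSignedInversiveDist {N : ℕ} (B₁ B₂ : Set (ExtSpace N)) (d : ℝ) : Prop :=
  ∃ f ∈ mobiusGroup N, ∃ (c₁ c₂ : EuclideanSpace ℝ (Fin N)) (r₁ r₂ ε₁ ε₂ : ℝ),
    0 < r₁ ∧ 0 < r₂ ∧
    IsSideOfEuclideanSphere (f '' B₁) c₁ r₁ ε₁ ∧ IsSideOfEuclideanSphere (f '' B₂) c₂ r₂ ε₂ ∧
    d = ε₁ * ε₂ * ((r₁ ^ 2 + r₂ ^ 2 - dist c₁ c₂ ^ 2) / (2 * r₁ * r₂))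

/-- The signed inversive distance `[B₁, B₂]` of two open balls (which need not be distinct; the
value for `B₁ = B₂` is `1`). For open balls in dimension at least one there is exactly one `d`
with `HasSignedInversiveDist B₁ B₂ d`. -/
def signedInversiveDist {N : ℕ} (B₁ B₂ : Set (ExtSpace N)) : ℝ :=
  Classical.epsilon (HasSignedInversiveDist B₁ B₂)

end InversiveGeometry

end

/-! The extended space is the projectivised null cone of a Lorentz space of signature `(N+1, 1)`. A
point `x` becomes a future null vector `pointVec x`. An open ball becomes a unit spacelike vector
`v`, being the set where the product of `v` with `pointVec x` is positive. In this model the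
complementary ball is `-v`, inversions lift to Lorentz reflections, and the signed inversive
distance of two balls is the Lorentz product of their vectors (`signedInversiveDist_positiveSide`).
Invariance of the distance under Möbius maps is then immediate.

The converse is a congruence theorem of Witt type, `exists_reflection_of_gram_eq`: equal Gram
matrices give a product of reflections carrying one family to the other up to a global sign. A
nonzero null vector orthogonal to the first family would be a point common to all the spheres, so
the empty intersection excludes it.

The congruence reduces to the Euclidean one by finding unit timelike `t`, `t'` with matching
products against the two families (`exists_reflection_of_timelike`). If the span of the first family
has a timelike vector, the same linear combination of the second family serves as `t'`. Otherwise
that span is positive definite and, for want of null normals, equals `t^⊥` for some timelike `t`; by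
a dimension count the second span is also positive definite, and `t'` is orthogonal to it.

The reflections used preserve the time direction, so `t` may land on `-t'`. This is where the
alternative with complementary balls comes from. -/

open scoped OnePoint

namespace InversiveGeometry

/-! ### Lorentz reflections and congruence of families of vectors -/

section Lorentz

variable {H : Type*} [NormedAddCommGroup H] [InnerProductSpace ℝ H]

/-- The Lorentz form on `H × ℝ`. -/
noncomputable def lorentzForm (H : Type*) [NormedAddCommGroup H] [InnerProductSpace ℝ H] :
    LinearMap.BilinForm ℝ (H × ℝ) :=
  LinearMap.mk₂ ℝ (fun x y => inner ℝ x.1 y.1 - x.2 * y.2)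
    (fun x y z => by simp only [Prod.fst_add, Prod.snd_add, inner_add_left]; ring)
    (fun c x y => by
      simp only [Prod.smul_fst, Prod.smul_snd, real_inner_smul_left, smul_eq_mul]; ring)
    (fun x y z => by simp only [Prod.fst_add, Prod.snd_add, inner_add_right]; ring)
    (fun c x y => by
      simp only [Prod.smul_fst, Prod.smul_snd, real_inner_smul_right, smul_eq_mul]; ring)

theorem lorentzForm_apply (x y : H × ℝ) :
    lorentzForm H x y = inner ℝ x.1 y.1 - x.2 * y.2 := rfl

theorem lorentzForm_comm (x y : H × ℝ) : lorentzForm H x y = lorentzForm H y x := by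
  simp only [lorentzForm_apply, real_inner_comm, mul_comm]

theorem lorentzForm_self (x : H × ℝ) : lorentzForm H x x = ‖x.1‖ ^ 2 - x.2 ^ 2 := by
  rw [lorentzForm_apply, real_inner_self_eq_norm_sq]; ring

theorem lorentzForm_isRefl : (lorentzForm H).IsRefl := fun x y h => by
  rw [lorentzForm_comm, h]

/-- The reflection of `H × ℝ` along a vector `u` with `⟨u, u⟩ = 1`. -/
noncomputable def lorentzReflection (u : H × ℝ) (hu : lorentzForm H u u = 1) :
    (H × ℝ) ≃ₗ[ℝ] (H × ℝ) :=
  LinearEquiv.ofInvolutive (LinearMap.id - (2 : ℝ) • (lorentzForm H u).smulRight u) (fun w => by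
    simp only [LinearMap.sub_apply, LinearMap.id_apply, LinearMap.smul_apply,
      LinearMap.smulRight_apply, map_sub, map_smul, hu]
    module)

theorem lorentzReflection_apply (u : H × ℝ) (hu : lorentzForm H u u = 1) (w : H × ℝ) :
    lorentzReflection u hu w = w - (2 * lorentzForm H u w) • u := by
  rw [mul_smul]
  rfl

/-- The group generated by the reflections along unit spacelike vectors. -/
def lorentzReflectionGroup (H : Type*) [NormedAddCommGroup H] [InnerProductSpace ℝ H] :
    Subgroup ((H × ℝ) ≃ₗ[ℝ] (H × ℝ)) :=
  Subgroup.closure {g | ∃ (u : H × ℝ) (hu : lorentzForm H u u = 1), g = lorentzReflection u hu}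

theorem lorentzReflection_mem (u : H × ℝ) (hu : lorentzForm H u u = 1) :
    lorentzReflection u hu ∈ lorentzReflectionGroup H :=
  Subgroup.subset_closure ⟨u, hu, rfl⟩

theorem lorentzForm_reflection (u : H × ℝ) (hu : lorentzForm H u u = 1) (x y : H × ℝ) :
    lorentzForm H (lorentzReflection u hu x) (lorentzReflection u hu y) = lorentzForm H x y := by
  simp only [lorentzReflection_apply, map_sub, map_smul, LinearMap.sub_apply,
    LinearMap.smul_apply, hu, smul_eq_mul, lorentzForm_comm x u]
  ring

theorem lorentzForm_map {g : (H × ℝ) ≃ₗ[ℝ] (H × ℝ)} (hg : g ∈ lorentzReflectionGroup H)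
    (x y : H × ℝ) : lorentzForm H (g x) (g y) = lorentzForm H x y := by
  induction hg using Subgroup.closure_induction generalizing x y with
  | mem g hg =>
    obtain ⟨u, hu, rfl⟩ := hg
    exact lorentzForm_reflection u hu x y
  | one => rfl
  | mul g h _ _ hg hh => rw [LinearEquiv.mul_apply, LinearEquiv.mul_apply, hg, hh]
  | inv g _ hg =>
    rw [← hg (g⁻¹ x), ← LinearEquiv.mul_apply, ← LinearEquiv.mul_apply, mul_inv_cancel]
    rfl

/-- Vectors of equal norm are exchanged by the reflection along their difference, once it is
normalised. Here the difference is spacelike unless `t` is already the base vector. -/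
theorem exists_reflection_eq_base_of_pos {t : H × ℝ} (ht : lorentzForm H t t = -1)
    (h0 : 0 < t.2) : ∃ g ∈ lorentzReflectionGroup H, g t = (0, 1) := by
  have hself := lorentzForm_self t
  rw [ht] at hself
  have h1 : 1 ≤ t.2 := by nlinarith [sq_nonneg ‖t.1‖]
  rcases h1.eq_or_lt with h1 | h1
  · refine ⟨1, one_mem _, ?_⟩
    have : ‖t.1‖ ^ 2 = 0 := by rw [← h1] at hself; linarith
    have h2 : t.1 = 0 := by simpa using this
    exact Prod.ext h2 h1.symm
  -- The Lorentz square of `t - (0, 1)` is `-1 - 1 + 2 * t.2`.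
  · set s : ℝ := Real.sqrt (2 * (t.2 - 1)) with hs
    have hs2 : s ^ 2 = 2 * (t.2 - 1) := Real.sq_sqrt (by linarith)
    have hs0 : s ≠ 0 := (Real.sqrt_pos.2 (by linarith)).ne'
    have e1 : lorentzForm H t (0, 1) = - t.2 := by simp [lorentzForm_apply]
    have e2 : lorentzForm H (0, 1) t = - t.2 := by simp [lorentzForm_apply]
    have e3 : lorentzForm H ((0, 1) : H × ℝ) (0, 1) = - 1 := by simp [lorentzForm_apply]
    have hu : lorentzForm H (s⁻¹ • (t - (0, 1))) (s⁻¹ • (t - (0, 1))) = 1 := by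
      simp only [map_sub, map_smul, LinearMap.sub_apply, LinearMap.smul_apply, smul_eq_mul, e1, e2,
        e3, ht]
      field_simp
      rw [hs2]; ring
    refine ⟨_, lorentzReflection_mem _ hu, ?_⟩
    rw [lorentzReflection_apply]
    have : 2 * lorentzForm H (s⁻¹ • (t - (0, 1))) t = s := by
      simp only [map_sub, map_smul, LinearMap.sub_apply, LinearMap.smul_apply, smul_eq_mul, e2, ht]
      field_simp
      rw [hs2]; ring
    rw [this, smul_smul, mul_inv_cancel₀ hs0, one_smul]
    abel

theorem exists_reflection_eq_base {t : H × ℝ} (ht : lorentzForm H t t = -1) :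
    ∃ g ∈ lorentzReflectionGroup H, ∃ ε : ℝ, (ε = 1 ∨ ε = -1) ∧ g t = ε • (0, 1) := by
  have hself := lorentzForm_self t
  rcases lt_trichotomy t.2 0 with h | h | h
  · obtain ⟨g, hg, h1⟩ := exists_reflection_eq_base_of_pos (t := -t) (by simpa using ht)
      (by simpa using h)
    refine ⟨g, hg, -1, Or.inr rfl, ?_⟩
    rw [← h1]; simp
  · rw [ht, h] at hself
    nlinarith [sq_nonneg ‖t.1‖]
  · obtain ⟨g, hg, h1⟩ := exists_reflection_eq_base_of_pos ht h
    exact ⟨g, hg, 1, Or.inl rfl, by simp [h1]⟩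

/-- Equal Gram matrices make `L x ↦ L' x` well defined and isometric on the span of `h`; finite
dimension allows an extension to all of `H`. -/
theorem exists_linearIsometryEquiv_of_inner_eq [FiniteDimensional ℝ H] {A : Type*} {h h' : A → H}
    (hh : ∀ α β, inner ℝ (h α) (h β) = inner ℝ (h' α) (h' β)) :
    ∃ φ : H ≃ₗᵢ[ℝ] H, ∀ α, φ (h α) = h' α := by
  let L := Finsupp.linearCombination ℝ h
  let L' := Finsupp.linearCombination ℝ h'
  have hL : ∀ x y, inner ℝ (L x) (L y) = inner ℝ (L' x) (L' y) := by
    intro x y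
    simp only [L, L', Finsupp.linearCombination_apply, Finsupp.sum, real_inner_smul_left, real_inner_smul_right, sum_inner, inner_sum, hh]
  have hker : LinearMap.ker L ≤ LinearMap.ker L' := by
    intro x hx
    rw [LinearMap.mem_ker] at hx ⊢
    rw [← inner_self_eq_zero (𝕜 := ℝ), ← hL, hx, inner_zero_left]
  let f : LinearMap.range L →ₗ[ℝ] H :=
    (Submodule.liftQ _ L' hker).comp L.quotKerEquivRange.symm.toLinearMap
  have hf : ∀ x, f ⟨L x, LinearMap.mem_range_self L x⟩ = L' x := by
    intro x
    have : L.quotKerEquivRange.symm ⟨L x, LinearMap.mem_range_self L x⟩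
        = Submodule.Quotient.mk x := by
      rw [LinearEquiv.symm_apply_eq]; rfl
    simp only [f, LinearMap.comp_apply, LinearEquiv.coe_coe, this]
    exact Submodule.liftQ_apply _ _ _
  let F : LinearMap.range L →ₗᵢ[ℝ] H := f.isometryOfInner (by
    rintro ⟨_, x, rfl⟩ ⟨_, y, rfl⟩
    rw [hf, hf, ← hL]; rfl)
  refine ⟨F.extend.toLinearIsometryEquiv rfl, fun α => ?_⟩
  have h1 : L (Finsupp.single α 1) = h α := by simp [L]
  have h2 : L' (Finsupp.single α 1) = h' α := by simp [L']
  have h3 := F.extend_apply ⟨L (Finsupp.single α 1), LinearMap.mem_range_self L _⟩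
  rw [LinearIsometry.coe_toLinearIsometryEquiv, ← h1, ← h2, h3.trans (hf _)]

theorem exists_mem_lorentzReflectionGroup_prod_reflection (u : H) :
    ∃ g ∈ lorentzReflectionGroup H, ∀ x : H × ℝ, g x = ((ℝ ∙ u)ᗮ.reflection x.1, x.2) := by
  by_cases hu : u = 0
  · exact ⟨1, one_mem _, fun x => by
      subst hu
      rw [(Submodule.reflection_eq_self_iff _).2 (by simp)]
      rfl⟩
  · have hn : ‖u‖ ≠ 0 := norm_ne_zero_iff.2 hu
    have h1 : lorentzForm H (‖u‖⁻¹ • u, 0) (‖u‖⁻¹ • u, 0) = 1 := by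
      rw [lorentzForm_self]
      simp [norm_smul, hn]
    refine ⟨_, lorentzReflection_mem _ h1, fun x => ?_⟩
    rw [lorentzReflection_apply, lorentzForm_apply, Submodule.reflection_orthogonal_apply,
      Submodule.reflection_singleton_apply]
    refine Prod.ext ?_ (by simp)
    simp only [Prod.fst_sub, Prod.smul_fst, real_inner_smul_left, smul_smul, RCLike.ofReal_real_eq_id,
      id, neg_sub, zero_mul, sub_zero]
    congr 1
    rw [two_smul, ← add_smul]
    congr 1
    field_simp
    ring

theorem exists_mem_lorentzReflectionGroup_prod_isometry [FiniteDimensional ℝ H] (φ : H ≃ₗᵢ[ℝ] H) :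
    ∃ g ∈ lorentzReflectionGroup H, ∀ x : H × ℝ, g x = (φ x.1, x.2) := by
  obtain ⟨l, -, rfl⟩ := φ.reflections_generate_dim
  induction l with
  | nil => exact ⟨1, one_mem _, fun x => by simp⟩
  | cons u l ih =>
    obtain ⟨g, hg, h1⟩ := ih
    obtain ⟨g', hg', h2⟩ := exists_mem_lorentzReflectionGroup_prod_reflection u
    refine ⟨g' * g, mul_mem hg' hg, fun x => ?_⟩
    rw [LinearEquiv.mul_apply, h1, h2]
    simp

/-- Families with equal Gram matrices and equal products with a timelike vector are congruent. -/
theorem exists_reflection_of_timelike [FiniteDimensional ℝ H] {A : Type*} {v v' : A → H × ℝ}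
    (hv : ∀ α β, lorentzForm H (v α) (v β) = lorentzForm H (v' α) (v' β)) {t t' : H × ℝ}
    (ht : lorentzForm H t t = -1) (ht' : lorentzForm H t' t' = -1)
    (htv : ∀ α, lorentzForm H t (v α) = lorentzForm H t' (v' α)) :
    ∃ g ∈ lorentzReflectionGroup H, ∃ ε : ℝ, (ε = 1 ∨ ε = -1) ∧ ∀ α, g (v α) = ε • v' α := by
  obtain ⟨g, hg, ε, hε, h1⟩ := exists_reflection_eq_base ht
  obtain ⟨g', hg', ε', hε', h2⟩ := exists_reflection_eq_base ht'
  have he : ε * ε = 1 := by rcases hε with rfl | rfl <;> norm_num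
  have he' : ε' * ε' = 1 := by rcases hε' with rfl | rfl <;> norm_num
  have snd_eq : ∀ x : H × ℝ, x.2 = - lorentzForm H (0, 1) x := fun x => by
    simp [lorentzForm_apply]
  -- With `t` and `t'` moved to the time axis, their products with the families are time coordinates
  -- up to sign. These agree, so the spatial parts have equal Gram matrices.
  have hs : ∀ α, ε * (g (v α)).2 = ε' * (g' (v' α)).2 := by
    intro α
    have e := htv α
    rw [← lorentzForm_map hg, ← lorentzForm_map hg' t', h1, h2] at e
    simp only [map_smul, LinearMap.smul_apply, smul_eq_mul] at e
    rw [snd_eq, snd_eq]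
    linarith
  have hh : ∀ α β, inner ℝ (ε • (g (v α)).1) (ε • (g (v β)).1) =
      inner ℝ (ε' • (g' (v' α)).1) (ε' • (g' (v' β)).1) := by
    intro α β
    have e := hv α β
    rw [← lorentzForm_map hg, ← lorentzForm_map hg' (v' α), lorentzForm_apply,
      lorentzForm_apply] at e
    simp only [real_inner_smul_left, real_inner_smul_right]
    have e2 : (ε * ε) * ((g (v α)).2 * (g (v β)).2) =
        (ε' * ε') * ((g' (v' α)).2 * (g' (v' β)).2) := by
      linear_combination ε * (g (v β)).2 * hs α + ε' * (g' (v' α)).2 * hs β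
    rw [he, he'] at e2
    rw [← mul_assoc, ← mul_assoc, he, he']
    linarith
  obtain ⟨φ, hφ⟩ := exists_linearIsometryEquiv_of_inner_eq hh
  obtain ⟨k, hk, hk1⟩ := exists_mem_lorentzReflectionGroup_prod_isometry φ
  have key : ∀ α, k (ε • g (v α)) = ε' • g' (v' α) := by
    intro α
    rw [hk1]
    exact Prod.ext (by simpa using hφ α) (by simpa using hs α)
  refine ⟨g'⁻¹ * k * g, mul_mem (mul_mem (inv_mem hg') hk) hg, ε * ε', ?_, fun α => ?_⟩
  · rcases hε with rfl | rfl <;> rcases hε' with rfl | rfl <;> norm_num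
  · have h3 : k (g (v α)) = g' ((ε * ε') • v' α) := by
      have := congrArg (fun x => ε • x) (key α)
      simp only [map_smul, smul_smul, he, one_smul] at this
      rw [this, map_smul]
    rw [LinearEquiv.mul_apply, LinearEquiv.mul_apply, h3, ← LinearEquiv.mul_apply, inv_mul_cancel]
    rfl

theorem exists_add_orthogonal_of_pos [FiniteDimensional ℝ H] {W : Submodule ℝ (H × ℝ)}
    (hW : ∀ w ∈ W, w ≠ 0 → 0 < lorentzForm H w w) (x : H × ℝ) :
    ∃ w ∈ W, ∃ y, (∀ z ∈ W, lorentzForm H z y = 0) ∧ w + y = x := by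
  have hd : Disjoint W ((lorentzForm H).orthogonal W) := by
    rw [Submodule.disjoint_def]
    intro x hx hx'
    by_contra h
    exact (hW x hx h).ne' (hx' x hx)
  have hc := ((lorentzForm H).isCompl_orthogonal_iff_disjoint lorentzForm_isRefl).2 hd
  have hmem : x ∈ W ⊔ (lorentzForm H).orthogonal W := by
    rw [hc.sup_eq_top]; trivial
  obtain ⟨w, hw, y, hy, hwy⟩ := Submodule.mem_sup.1 hmem
  exact ⟨w, hw, y, fun z hz => hy z hz, hwy⟩

/-- The component of `(0, 1)` orthogonal to `W` has Lorentz square at most `-1`, since the component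
in `W` contributes a nonnegative amount. -/
theorem exists_timelike_orthogonal [FiniteDimensional ℝ H] (W : Submodule ℝ (H × ℝ))
    (hW : ∀ w ∈ W, w ≠ 0 → 0 < lorentzForm H w w) :
    ∃ t : H × ℝ, lorentzForm H t t = -1 ∧ ∀ w ∈ W, lorentzForm H t w = 0 := by
  obtain ⟨w, hw, y, hy', hwy⟩ := exists_add_orthogonal_of_pos hW ((0, 1) : H × ℝ)
  have h1 : lorentzForm H w w + lorentzForm H y y = -1 := by
    have e3 : lorentzForm H ((0, 1) : H × ℝ) (0, 1) = - 1 := by simp [lorentzForm_apply]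
    rw [← hwy] at e3
    simp only [map_add, LinearMap.add_apply, hy' w hw, lorentzForm_comm y w] at e3
    linarith
  have h2 : 0 ≤ lorentzForm H w w := by
    by_cases h : w = 0
    · simp [h]
    · exact (hW w hw h).le
  have h3 : 0 < - lorentzForm H y y := by linarith
  refine ⟨(Real.sqrt (- lorentzForm H y y))⁻¹ • y, ?_, fun w hw => ?_⟩
  · simp only [map_smul, LinearMap.smul_apply, smul_eq_mul]
    rw [← mul_assoc, ← mul_inv, Real.mul_self_sqrt h3.le]
    rw [inv_neg, neg_mul, inv_mul_cancel₀ (by linarith)]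
  · rw [lorentzForm_comm, map_smul, hy' w hw, smul_zero]

/-- Cauchy–Schwarz for the spatial parts: two vectors in the closed light cone, one of them timelike
and the other nonzero, are never orthogonal. -/
theorem lorentzForm_self_pos_of_orthogonal {t x : H × ℝ} (ht : lorentzForm H t t < 0)
    (hx : lorentzForm H t x = 0) (h0 : x ≠ 0) : 0 < lorentzForm H x x := by
  rw [lorentzForm_self] at ht ⊢
  rw [lorentzForm_apply] at hx
  by_contra hle
  push Not at hle
  have h1 := abs_real_inner_le_norm t.1 x.1
  have h2 : |inner ℝ t.1 x.1| = |t.2| * |x.2| := by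
    rw [← abs_mul]; congr 1; linarith
  have h3 : ‖t.1‖ < |t.2| := by
    rw [← abs_norm]; exact sq_lt_sq.1 (by linarith)
  have h4 : ‖x.1‖ ≤ |x.2| := by
    rw [← abs_norm]; exact sq_le_sq.1 (by linarith)
  have h5 : 0 ≤ ‖t.1‖ := norm_nonneg _
  have h6 : x.2 = 0 := by
    by_contra h
    have : 0 < |x.2| := abs_pos.2 h
    nlinarith
  have h7 : x.1 = 0 := by
    rw [h6, abs_zero] at h4
    exact norm_le_zero_iff.1 h4
  exact h0 (Prod.ext h7 h6)

theorem lorentzForm_eq_zero_of_semidefinite {W : Submodule ℝ (H × ℝ)}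
    (hW : ∀ w ∈ W, 0 ≤ lorentzForm H w w) {n w : H × ℝ} (hn : n ∈ W) (hw : w ∈ W)
    (h0 : lorentzForm H n n = 0) : lorentzForm H n w = 0 := by
  by_contra h
  set b := lorentzForm H n w with hb
  -- The square of `s • n + w` is affine in `s` with slope `2 * b`; this value of `s` makes it `-1`.
  have h1 := hW _ (W.add_mem (W.smul_mem (-(lorentzForm H w w + 1) / (2 * b)) hn) hw)
  simp only [map_add, LinearMap.add_apply, map_smul, LinearMap.smul_apply, smul_eq_mul, h0,
    lorentzForm_comm w n, ← hb] at h1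
  have h2 : -(lorentzForm H w w + 1) / (2 * b) * b = -(lorentzForm H w w + 1) / 2 := by
    field_simp
  linarith

theorem mem_of_orthogonal_timelike [FiniteDimensional ℝ H] {W : Submodule ℝ (H × ℝ)}
    (hW : ∀ w ∈ W, w ≠ 0 → 0 < lorentzForm H w w)
    (hnull : ∀ n : H × ℝ, lorentzForm H n n = 0 → (∀ w ∈ W, lorentzForm H n w = 0) → n = 0)
    {t x : H × ℝ} (ht : lorentzForm H t t = -1) (htW : ∀ w ∈ W, lorentzForm H t w = 0)
    (hx : lorentzForm H t x = 0) : x ∈ W := by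
  obtain ⟨w, hw, y, hy, rfl⟩ := exists_add_orthogonal_of_pos hW x
  have hty : lorentzForm H t y = 0 := by
    rwa [map_add, htW w hw, zero_add] at hx
  by_cases h : y = 0
  · rwa [h, add_zero]
  exfalso
  have hpos := lorentzForm_self_pos_of_orthogonal (by rw [ht]; norm_num) hty h
  set s := Real.sqrt (lorentzForm H y y) with hs
  have hs2 : s * s = lorentzForm H y y := Real.mul_self_sqrt hpos.le
  -- The timelike `t` and the spacelike `y`, scaled to opposite squares, add up to a null vector
  -- orthogonal to `W`.
  have h0 := hnull (s • t + y) (by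
      simp only [map_add, LinearMap.add_apply, map_smul, LinearMap.smul_apply, smul_eq_mul, ht,
        lorentzForm_comm y t, hty]
      linarith) (fun w hw => by
      simp only [map_add, LinearMap.add_apply, map_smul, LinearMap.smul_apply, smul_eq_mul,
        htW w hw, lorentzForm_comm y w, hy w hw]
      ring)
  have h1 : lorentzForm H t (s • t + y) = - s := by
    rw [map_add, map_smul, ht, hty, smul_eq_mul]; ring
  rw [h0, map_zero] at h1
  have : 0 < s := Real.sqrt_pos.2 hpos
  linarith

/-- A null vector orthogonal to an isometric image of the orthogonal complement of a timelike
vector vanishes. -/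
theorem eq_zero_of_null_of_orthogonal_range [FiniteDimensional ℝ H] {t : H × ℝ}
    (ht : lorentzForm H t t = -1) (φ : LinearMap.ker (lorentzForm H t) →ₗ[ℝ] H × ℝ)
    (hφ : ∀ w : LinearMap.ker (lorentzForm H t),
      lorentzForm H (φ w) (φ w) = lorentzForm H (w : H × ℝ) w)
    {n : H × ℝ} (hn : lorentzForm H n n = 0) (hnφ : ∀ w, lorentzForm H n (φ w) = 0) : n = 0 := by
  have hpos : ∀ w : LinearMap.ker (lorentzForm H t), lorentzForm H (φ w) (φ w) ≤ 0 → w = 0 := by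
    intro w hw
    by_contra h
    have := lorentzForm_self_pos_of_orthogonal (by rw [ht]; norm_num) (LinearMap.mem_ker.1 w.2)
      (fun h' => h (Subtype.ext h'))
    rw [hφ] at hw
    linarith
  let ψ : LinearMap.ker (lorentzForm H t) →ₗ[ℝ] H := (LinearMap.fst ℝ H ℝ).comp φ
  have hψ : ∀ w, ψ w = (φ w).1 := fun _ => rfl
  -- The image of `φ` is positive definite, so it meets the time axis only in zero, and projection
  -- to `H` is injective on it. By dimension some `φ w` has the spatial part of `n`.
  have hinj : Function.Injective ψ := by
    rw [← LinearMap.ker_eq_bot, LinearMap.ker_eq_bot']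
    intro w hw
    refine hpos w ?_
    rw [lorentzForm_self, ← hψ, hw, norm_zero]
    nlinarith [sq_nonneg (φ w).2]
  have hne : lorentzForm H t ≠ 0 := fun h => by
    rw [h] at ht; simp at ht
  have hrank : Module.finrank ℝ (LinearMap.ker (lorentzForm H t)) = Module.finrank ℝ H := by
    have h1 := Module.Dual.finrank_ker_add_one_of_ne_zero hne
    have h2 : Module.finrank ℝ (H × ℝ) = Module.finrank ℝ H + 1 := by simp
    omega
  obtain ⟨w, hw⟩ := (LinearMap.injective_iff_surjective_of_finrank_eq_finrank hrank).1 hinj n.1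
  have h1 := hnφ w
  rw [lorentzForm_self] at hn
  rw [lorentzForm_apply, ← hψ, hw, real_inner_self_eq_norm_sq] at h1
  -- If `n.2` were nonzero, orthogonality and nullity would force `φ w = n`, a null vector in a
  -- positive definite image.
  have h2 : n.2 = 0 := by
    by_contra h
    have h3 : n.2 = (φ w).2 := mul_left_cancel₀ h (by linarith)
    have h4 := hpos w (by rw [lorentzForm_self, ← hψ, hw, ← h3]; linarith)
    rw [h4, map_zero] at hw
    rw [← hw, norm_zero] at hn
    exact h (by simpa using hn)
  rw [h2] at hn
  exact Prod.ext (by simpa using hn) h2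

/-- Two families in `H × ℝ` with equal Gram matrices, no nonzero null vector being orthogonal to
all of the first, agree up to a global sign and a product of reflections. -/
theorem exists_reflection_of_gram_eq [FiniteDimensional ℝ H] {A : Type*} {v v' : A → H × ℝ}
    (hv : ∀ α β, lorentzForm H (v α) (v β) = lorentzForm H (v' α) (v' β))
    (hnull : ∀ n : H × ℝ, lorentzForm H n n = 0 → (∀ α, lorentzForm H n (v α) = 0) → n = 0) :
    ∃ g ∈ lorentzReflectionGroup H, ∃ ε : ℝ, (ε = 1 ∨ ε = -1) ∧ ∀ α, g (v α) = ε • v' α := by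
  let L := Finsupp.linearCombination ℝ v
  let L' := Finsupp.linearCombination ℝ v'
  have hL : ∀ x y, lorentzForm H (L x) (L y) = lorentzForm H (L' x) (L' y) := by
    intro x y
    simp only [L, L', Finsupp.linearCombination_apply, Finsupp.sum, map_sum, LinearMap.sum_apply,
      map_smul, LinearMap.smul_apply, hv]
  have hLs : ∀ α, L (Finsupp.single α 1) = v α := fun α => by simp [L]
  have hLs' : ∀ α, L' (Finsupp.single α 1) = v' α := fun α => by simp [L']
  suffices h : ∃ t t' : H × ℝ, lorentzForm H t t = -1 ∧ lorentzForm H t' t' = -1 ∧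
      ∀ α, lorentzForm H t (v α) = lorentzForm H t' (v' α) by
    obtain ⟨t, t', ht, ht', htv⟩ := h
    exact exists_reflection_of_timelike hv ht ht' htv
  -- Either a timelike vector lies in the span, or the form is semidefinite there.
  by_cases hneg : ∃ x, lorentzForm H (L x) (L x) < 0
  · obtain ⟨x, hx⟩ := hneg
    set s := Real.sqrt (- lorentzForm H (L x) (L x))
    have hs : s * s = - lorentzForm H (L x) (L x) := Real.mul_self_sqrt (by linarith)
    have hs0 : s ≠ 0 := fun h => by rw [h] at hs; linarith
    have h1 : lorentzForm H (L (s⁻¹ • x)) (L (s⁻¹ • x)) = -1 := by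
      simp only [map_smul, LinearMap.smul_apply, smul_eq_mul]
      rw [← mul_assoc, ← mul_inv, hs, inv_neg, neg_mul, inv_mul_cancel₀ hx.ne]
    exact ⟨L (s⁻¹ • x), L' (s⁻¹ • x), h1, by rw [← hL, h1],
      fun α => by rw [← hLs, ← hLs', hL]⟩
  · push Not at hneg
    have hnull' : ∀ n : H × ℝ, lorentzForm H n n = 0 →
        (∀ w ∈ LinearMap.range L, lorentzForm H n w = 0) → n = 0 := fun n hn h =>
      hnull n hn fun α => h _ ⟨Finsupp.single α 1, hLs α⟩
    have hsemi : ∀ w ∈ LinearMap.range L, 0 ≤ lorentzForm H w w := by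
      rintro _ ⟨x, rfl⟩; exact hneg x
    have hW : ∀ w ∈ LinearMap.range L, w ≠ 0 → 0 < lorentzForm H w w := fun w hw h0 =>
      (hsemi w hw).lt_of_ne fun h => h0 <| hnull' w h.symm fun w' hw' =>
        lorentzForm_eq_zero_of_semidefinite hsemi hw hw' h.symm
    obtain ⟨t, ht, htW⟩ := exists_timelike_orthogonal _ hW
    -- The span is the whole hyperplane `t^⊥`, so the second span contains an isometric copy of it
    -- and inherits the absence of null normals.
    have hker : LinearMap.ker (lorentzForm H t) ≤ LinearMap.range L := fun x hx =>
      mem_of_orthogonal_timelike hW hnull' ht htW hx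
    obtain ⟨e, he⟩ := L.rangeRestrict.exists_rightInverse_of_surjective L.range_rangeRestrict
    have he' : ∀ w, L (e w) = w := fun w => congrArg Subtype.val (LinearMap.congr_fun he w)
    have hn' : ∀ n : H × ℝ, lorentzForm H n n = 0 → (∀ x, lorentzForm H n (L' x) = 0) → n = 0 :=
      fun n hn h => eq_zero_of_null_of_orthogonal_range ht
        (L'.comp (e.comp (Submodule.inclusion hker)))
        (fun w => by
          simp only [LinearMap.comp_apply]
          rw [← hL, he']; rfl) hn (fun w => h _)
    have hW' : ∀ w ∈ LinearMap.range L', w ≠ 0 → 0 < lorentzForm H w w := by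
      rintro _ ⟨x, rfl⟩ h0
      rw [← hL]
      refine hW _ ⟨x, rfl⟩ fun h => h0 (hn' _ ?_ fun y => ?_)
      · rw [← hL, h, map_zero]
      · rw [← hL, h, map_zero, LinearMap.zero_apply]
    obtain ⟨t', ht', htW'⟩ := exists_timelike_orthogonal _ hW'
    exact ⟨t, t', ht, ht', fun α => by
      rw [htW _ ⟨_, hLs α⟩, htW' _ ⟨_, hLs' α⟩]⟩

end Lorentz

/-! ### Spheres, points and Möbius maps in Lorentz space -/

section Lift

variable {N : ℕ}

/-- The `N + 1` dimensional Euclidean space, the spacelike part of the Lorentz space of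
`ExtSpace N`. -/
abbrev SpacePart (N : ℕ) : Type := WithLp 2 (EuclideanSpace ℝ (Fin N) × ℝ)

/-- The vector of the Lorentz space whose zero set in `ℝ^N` is `a |x|² - 2 ⟨b, x⟩ + c = 0`. -/
noncomputable def quadricVec (b : EuclideanSpace ℝ (Fin N)) (a c : ℝ) : SpacePart N × ℝ :=
  (WithLp.toLp 2 (b, (c - a) / 2), (a + c) / 2)

theorem lorentzForm_quadricVec (b b' : EuclideanSpace ℝ (Fin N)) (a a' c c' : ℝ) :
    lorentzForm _ (quadricVec b a c) (quadricVec b' a' c') =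
      inner ℝ b b' - (a * c' + a' * c) / 2 := by
  simp only [quadricVec, lorentzForm_apply, WithLp.prod_inner_apply,
    RCLike.inner_apply, conj_trivial]
  ring

theorem exists_eq_quadricVec (v : SpacePart N × ℝ) : ∃ b a c, v = quadricVec b a c := by
  refine ⟨v.1.fst, v.2 - v.1.snd, v.2 + v.1.snd, Prod.ext ?_ ?_⟩
  · refine (WithLp.equiv 2 _).injective (Prod.ext rfl ?_)
    change v.1.snd = (v.2 + v.1.snd - (v.2 - v.1.snd)) / 2
    ring
  · change v.2 = (v.2 - v.1.snd + (v.2 + v.1.snd)) / 2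
    ring

theorem smul_quadricVec (s : ℝ) (b : EuclideanSpace ℝ (Fin N)) (a c : ℝ) :
    s • quadricVec b a c = quadricVec (s • b) (s * a) (s * c) := by
  refine Prod.ext ?_ ?_
  · refine (WithLp.equiv 2 _).injective (Prod.ext rfl ?_)
    change s * ((c - a) / 2) = (s * c - s * a) / 2
    ring
  · change s * ((a + c) / 2) = (s * a + s * c) / 2
    ring

theorem sub_quadricVec (b b' : EuclideanSpace ℝ (Fin N)) (a a' c c' : ℝ) :
    quadricVec b a c - quadricVec b' a' c' = quadricVec (b - b') (a - a') (c - c') := by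
  refine Prod.ext ?_ ?_
  · refine (WithLp.equiv 2 _).injective (Prod.ext rfl ?_)
    change (c - a) / 2 - (c' - a') / 2 = (c - c' - (a - a')) / 2
    ring
  · change (a + c) / 2 - (a' + c') / 2 = (a - a' + (c - c')) / 2
    ring

/-- The vector of the sphere with centre `c` and radius `1 / |a|`. -/
noncomputable def sphereVec (c : EuclideanSpace ℝ (Fin N)) (a : ℝ) : SpacePart N × ℝ :=
  quadricVec (a • c) a (a * ‖c‖ ^ 2 - 1 / a)

theorem neg_sphereVec (c : EuclideanSpace ℝ (Fin N)) (a : ℝ) :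
    - sphereVec c a = sphereVec c (-a) := by
  rw [← neg_one_smul ℝ, sphereVec, sphereVec, smul_quadricVec]
  congr 1
  · module
  · ring
  · rw [one_div_neg_eq_neg_one_div]; ring

/-- For `a = ±1 / r` and `a' = ±1 / r'` this is the signed inversive distance; the sign of `a`
selects the inside or the outside. -/
theorem lorentzForm_sphereVec (c c' : EuclideanSpace ℝ (Fin N)) {a a' : ℝ} :
    lorentzForm _ (sphereVec c a) (sphereVec c' a') =
      (a / a' + a' / a - a * a' * dist c c' ^ 2) / 2 := by
  rw [sphereVec, sphereVec, lorentzForm_quadricVec, dist_eq_norm, norm_sub_sq_real,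
    real_inner_smul_left, real_inner_smul_right]
  ring

theorem lorentzForm_sphereVec_self (c : EuclideanSpace ℝ (Fin N)) {a : ℝ} (ha : a ≠ 0) :
    lorentzForm _ (sphereVec c a) (sphereVec c a) = 1 := by
  rw [lorentzForm_sphereVec, dist_self, div_self ha]; norm_num

/-- Unit vectors represent Euclidean spheres or planes. -/
theorem exists_sphereVec_or_plane {v : SpacePart N × ℝ} (hv : lorentzForm _ v v = 1) :
    (∃ c a, a ≠ 0 ∧ v = sphereVec c a) ∨ ∃ b k, ‖b‖ = 1 ∧ v = quadricVec b 0 k := by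
  obtain ⟨b, a, c, rfl⟩ := exists_eq_quadricVec v
  rw [lorentzForm_quadricVec, real_inner_self_eq_norm_sq] at hv
  by_cases ha : a = 0
  · subst ha
    right
    refine ⟨b, c, ?_, rfl⟩
    have : ‖b‖ ^ 2 = 1 := by linarith
    rwa [pow_eq_one_iff_of_nonneg (norm_nonneg _) two_ne_zero] at this
  · left
    refine ⟨a⁻¹ • b, a, ha, ?_⟩
    rw [sphereVec, smul_inv_smul₀ ha, norm_smul, mul_pow, Real.norm_eq_abs, sq_abs]
    congr 1
    field_simp
    linarith

/-- The null vector representing a point of the extended space. -/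
noncomputable def pointVec (x : ExtSpace N) : SpacePart N × ℝ :=
  x.elim (quadricVec 0 0 1) (fun y => quadricVec y 1 (‖y‖ ^ 2))

theorem pointVec_infty : pointVec (∞ : ExtSpace N) = quadricVec 0 0 1 := rfl

theorem pointVec_coe (y : EuclideanSpace ℝ (Fin N)) :
    pointVec (y : ExtSpace N) = quadricVec y 1 (‖y‖ ^ 2) := rfl

theorem lorentzForm_pointVec_coe (b y : EuclideanSpace ℝ (Fin N)) (a c : ℝ) :
    lorentzForm _ (quadricVec b a c) (pointVec (y : ExtSpace N)) =
      inner ℝ b y - (a * ‖y‖ ^ 2 + c) / 2 := by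
  rw [pointVec_coe, lorentzForm_quadricVec, one_mul]

theorem lorentzForm_pointVec_infty (b : EuclideanSpace ℝ (Fin N)) (a c : ℝ) :
    lorentzForm _ (quadricVec b a c) (pointVec (∞ : ExtSpace N)) = - a / 2 := by
  rw [pointVec_infty, lorentzForm_quadricVec, inner_zero_right]
  ring

theorem lorentzForm_sphereVec_pointVec (c y : EuclideanSpace ℝ (Fin N)) (a : ℝ) :
    lorentzForm _ (sphereVec c a) (pointVec (y : ExtSpace N)) =
      (1 / a - a * dist y c ^ 2) / 2 := by
  rw [sphereVec, lorentzForm_pointVec_coe, dist_eq_norm, norm_sub_sq_real, real_inner_smul_left,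
    real_inner_comm]
  ring

theorem exists_eq_smul_pointVec {n : SpacePart N × ℝ} (hn : lorentzForm _ n n = 0) (h0 : n ≠ 0) :
    ∃ (μ : ℝ) (x : ExtSpace N), μ ≠ 0 ∧ n = μ • pointVec x := by
  obtain ⟨b, a, c, rfl⟩ := exists_eq_quadricVec n
  rw [lorentzForm_quadricVec, real_inner_self_eq_norm_sq] at hn
  by_cases ha : a = 0
  · subst ha
    have hb : b = 0 := by
      have : ‖b‖ ^ 2 = 0 := by linarith
      simpa using this
    subst hb
    refine ⟨c, ∞, ?_, ?_⟩
    · rintro rfl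
      apply h0
      have := smul_quadricVec (N := N) 0 0 0 0
      simpa using this.symm
    · rw [pointVec_infty, smul_quadricVec, smul_zero, mul_zero, mul_one]
  · refine ⟨a, ((a⁻¹ • b : EuclideanSpace ℝ (Fin N)) : ExtSpace N), ha, ?_⟩
    rw [pointVec_coe, smul_quadricVec, smul_inv_smul₀ ha, mul_one, norm_smul, mul_pow,
      Real.norm_eq_abs, sq_abs]
    congr 1
    field_simp
    linarith

/-- The linear map `g` induces the permutation `f` of the extended space. -/
def IsLift (f : Equiv.Perm (ExtSpace N)) (g : (SpacePart N × ℝ) ≃ₗ[ℝ] (SpacePart N × ℝ)) : Prop :=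
  ∀ x, ∃ r : ℝ, 0 < r ∧ pointVec (f x) = r • g (pointVec x)

theorem IsLift.mul {f f' : Equiv.Perm (ExtSpace N)} {g g'} (h : IsLift f g) (h' : IsLift f' g') :
    IsLift (f * f') (g * g') := by
  intro x
  obtain ⟨r', hr', e'⟩ := h' x
  obtain ⟨r, hr, e⟩ := h (f' x)
  exact ⟨r * r', mul_pos hr hr', by
    rw [Equiv.Perm.mul_apply, LinearEquiv.mul_apply, e, e', map_smul, smul_smul]⟩

theorem IsLift.inv {f : Equiv.Perm (ExtSpace N)} {g} (h : IsLift f g) : IsLift f⁻¹ g⁻¹ := by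
  intro x
  obtain ⟨r, hr, e⟩ := h (f⁻¹ x)
  refine ⟨r⁻¹, inv_pos.2 hr, ?_⟩
  rw [← Equiv.Perm.mul_apply, mul_inv_cancel, Equiv.Perm.one_apply] at e
  rw [e, map_smul, smul_smul, inv_mul_cancel₀ hr.ne', one_smul, ← LinearEquiv.mul_apply,
    inv_mul_cancel]
  rfl

theorem isLift_one : IsLift (1 : Equiv.Perm (ExtSpace N)) 1 := fun x => ⟨1, one_pos, by simp⟩

/-- Only `a ^ 2` is prescribed, because `u` and `-u` define the same reflection. -/
theorem isLift_sphereInversion (c : EuclideanSpace ℝ (Fin N)) (r : ℝ) (hr : 0 < r) {a : ℝ}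
    (ha : a ^ 2 = (r ^ 2)⁻¹) (hu : lorentzForm _ (sphereVec c a) (sphereVec c a) = 1) :
    IsLift (sphereInversion c r hr) (lorentzReflection (sphereVec c a) hu) := by
  have hr2 : r ^ 2 ≠ 0 := by positivity
  have ha0 : a ≠ 0 := by
    rintro rfl
    rw [zero_pow two_ne_zero, eq_comm, inv_eq_zero] at ha
    exact hr2 ha
  have ha' : 1 / a = a * r ^ 2 := by
    field_simp
    rw [ha, inv_mul_cancel₀ hr2]
  have har : a * a * r ^ 2 = 1 := by rw [← sq, ha, inv_mul_cancel₀ hr2]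
  intro x
  rw [lorentzReflection_apply]
  induction x using OnePoint.rec with
  | infty =>
    refine ⟨r ^ 2, by positivity, ?_⟩
    change pointVec (c : ExtSpace N) = _
    rw [sphereVec, lorentzForm_pointVec_infty, pointVec_infty, smul_quadricVec, sub_quadricVec,
      smul_quadricVec, pointVec_coe, ha']
    congr 1
    · rw [zero_sub, smul_neg, smul_smul, smul_smul, ← neg_smul]
      conv_lhs => rw [← one_smul ℝ c]
      congr 1
      linear_combination -har
    · linear_combination -har
    · linear_combination (r ^ 2 - ‖c‖ ^ 2) * har
  | coe y =>
    by_cases h : y = c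
    · subst h
      refine ⟨(r ^ 2)⁻¹, by positivity, ?_⟩
      have : sphereInversion y r hr (y : ExtSpace N) = ∞ := by
        simp [sphereInversion, sphereInversionFun]
      rw [this, lorentzForm_sphereVec_pointVec, dist_self, pointVec_infty, pointVec_coe, sphereVec,
        smul_quadricVec, sub_quadricVec, smul_quadricVec, ha']
      congr 1
      · rw [smul_smul]
        have : 2 * ((a * r ^ 2 - a * 0 ^ 2) / 2) * a = 1 := by linear_combination har
        rw [this, one_smul, sub_self, smul_zero]
      · field_simp
        linear_combination har
      · field_simp
        linear_combination (‖y‖ ^ 2 - r ^ 2) * har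
    · have hd : 0 < dist y c := dist_pos.2 h
      refine ⟨(r / dist y c) ^ 2, by positivity, ?_⟩
      have : sphereInversion c r hr (y : ExtSpace N) =
          ((EuclideanGeometry.inversion c r y : EuclideanSpace ℝ (Fin N)) : ExtSpace N) := by
        simp [sphereInversion, sphereInversionFun, h]
      rw [this, lorentzForm_sphereVec_pointVec, pointVec_coe, pointVec_coe, sphereVec,
        smul_quadricVec, sub_quadricVec, smul_quadricVec, ha',
        show EuclideanGeometry.inversion c r y = (r / dist y c) ^ 2 • (y - c) + c from rfl]
      set d := dist y c
      have hl : (r / d) ^ 2 * d ^ 2 = r ^ 2 := by field_simp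
      have hn : d ^ 2 = ‖y‖ ^ 2 - 2 * inner ℝ y c + ‖c‖ ^ 2 := by
        rw [← norm_sub_sq_real, ← dist_eq_norm]
      set l := (r / d) ^ 2
      -- The factor `l` is exactly what normalises the quadratic coefficient of the reflected null
      -- vector to `1`.
      have hm : l * (1 - (a * r ^ 2 - a * d ^ 2) * a) = 1 := by
        linear_combination (1 - l) * har + a * a * hl
      congr 1
      · have e : l * (2 * ((a * r ^ 2 - a * d ^ 2) / 2) * a) = l - 1 := by
          linear_combination -hm
        simp only [smul_sub, smul_smul, e]
        module
      · linear_combination -hm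
      · rw [norm_add_sq_real, norm_smul, real_inner_smul_left, inner_sub_left, mul_pow,
          Real.norm_eq_abs, sq_abs, ← dist_eq_norm, real_inner_self_eq_norm_sq]
        change l ^ 2 * d ^ 2 + _ + _ = _
        linear_combination (l - 1 - (a * a * (‖c‖ ^ 2 - r ^ 2))) * hl +
          (l * (‖c‖ ^ 2 - r ^ 2) - (‖c‖ ^ 2 - r ^ 2)) * har + l * hn

theorem planeReflection_coe (p n y : EuclideanSpace ℝ (Fin N)) :
    planeReflection p n (y : ExtSpace N) =
      (((y - (2 * (inner ℝ n (y - p) / ‖n‖ ^ 2)) • n : EuclideanSpace ℝ (Fin N))) :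
        ExtSpace N) := by
  change ((EuclideanGeometry.reflection (euclideanPlane p n) y : EuclideanSpace ℝ (Fin N)) :
    ExtSpace N) = _
  rw [EuclideanGeometry.reflection_apply_of_mem _ _ (AffineSubspace.self_mem_mk' p _)]
  simp only [AffineSubspace.direction_mk', Submodule.reflection_orthogonal_apply,
    Submodule.reflection_singleton_apply, vsub_eq_sub, vadd_eq_add, RCLike.ofReal_real_eq_id, id]
  congr 1
  module

theorem isLift_planeReflection (p : EuclideanSpace ℝ (Fin N)) {n b : EuclideanSpace ℝ (Fin N)}
    (hn : n ≠ 0) (hb : b = ‖n‖⁻¹ • n) {k : ℝ} (hk : k = 2 * inner ℝ b p)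
    (hu : lorentzForm _ (quadricVec b 0 k) (quadricVec b 0 k) = 1) :
    IsLift (planeReflection p n) (lorentzReflection (quadricVec b 0 k) hu) := by
  have hn0 : ‖n‖ ≠ 0 := norm_ne_zero_iff.2 hn
  have hbn : ‖b‖ = 1 := by rw [hb, norm_smul, norm_inv, norm_norm, inv_mul_cancel₀ hn0]
  intro x
  refine ⟨1, one_pos, ?_⟩
  rw [one_smul, lorentzReflection_apply]
  induction x using OnePoint.rec with
  | infty =>
    change pointVec (∞ : ExtSpace N) = _
    rw [lorentzForm_pointVec_infty]
    simp
  | coe y =>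
    have h1 : (2 * (inner ℝ n (y - p) / ‖n‖ ^ 2)) • n = (2 * inner ℝ b y - k) • b := by
      rw [hk, hb, smul_smul, real_inner_smul_left, real_inner_smul_left, inner_sub_right]
      congr 1
      field_simp
    rw [planeReflection_coe, h1, pointVec_coe, pointVec_coe, lorentzForm_quadricVec,
      smul_quadricVec, sub_quadricVec]
    congr 1
    · congr 2
      ring
    · ring
    · rw [norm_sub_sq_real, norm_smul, mul_pow, hbn, Real.norm_eq_abs, sq_abs,
        real_inner_smul_right, real_inner_comm]
      ring

theorem exists_isLift_of_isInversion {σ : Equiv.Perm (ExtSpace N)} (hσ : IsInversion σ) :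
    ∃ g ∈ lorentzReflectionGroup (SpacePart N), IsLift σ g := by
  rcases hσ with ⟨c, r, hr, rfl⟩ | ⟨p, n, hn, rfl⟩
  · have hu := lorentzForm_sphereVec_self c (inv_ne_zero hr.ne')
    exact ⟨_, lorentzReflection_mem _ hu, isLift_sphereInversion c r hr (inv_pow r 2) hu⟩
  · have hu : lorentzForm _ (quadricVec (‖n‖⁻¹ • n) 0 (2 * inner ℝ (‖n‖⁻¹ • n) p))
        (quadricVec (‖n‖⁻¹ • n) 0 (2 * inner ℝ (‖n‖⁻¹ • n) p)) = 1 := by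
      rw [lorentzForm_quadricVec, real_inner_self_eq_norm_sq, norm_smul, norm_inv, norm_norm,
        inv_mul_cancel₀ (norm_ne_zero_iff.2 hn)]
      norm_num
    exact ⟨_, lorentzReflection_mem _ hu, isLift_planeReflection p hn rfl rfl hu⟩

theorem exists_isInversion_isLift (u : SpacePart N × ℝ) (hu : lorentzForm _ u u = 1) :
    ∃ σ : Equiv.Perm (ExtSpace N), IsInversion σ ∧ IsLift σ (lorentzReflection u hu) := by
  rcases exists_sphereVec_or_plane hu with ⟨c, a, ha, rfl⟩ | ⟨b, k, hb, rfl⟩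
  · have hr : 0 < |a|⁻¹ := inv_pos.2 (abs_pos.2 ha)
    exact ⟨_, Or.inl ⟨c, _, hr, rfl⟩, isLift_sphereInversion c _ hr (by simp) hu⟩
  · have hb0 : b ≠ 0 := norm_ne_zero_iff.1 (by rw [hb]; norm_num)
    -- The plane is `⟨b, y⟩ = k / 2`, and `(k / 2) • b` is its point nearest the origin.
    refine ⟨_, Or.inr ⟨(k / 2) • b, b, hb0, rfl⟩, isLift_planeReflection _ hb0 ?_ ?_ hu⟩
    · rw [hb, inv_one, one_smul]
    · rw [real_inner_smul_right, real_inner_self_eq_norm_sq, hb]; ring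

theorem exists_isLift_of_mem_mobiusGroup {f : Equiv.Perm (ExtSpace N)} (hf : f ∈ mobiusGroup N) :
    ∃ g ∈ lorentzReflectionGroup (SpacePart N), IsLift f g := by
  induction hf using Subgroup.closure_induction with
  | mem σ hσ => exact exists_isLift_of_isInversion hσ
  | one => exact ⟨1, one_mem _, isLift_one⟩
  | mul f f' _ _ h h' =>
    obtain ⟨g, hg, e⟩ := h
    obtain ⟨g', hg', e'⟩ := h'
    exact ⟨g * g', mul_mem hg hg', e.mul e'⟩
  | inv f _ h =>
    obtain ⟨g, hg, e⟩ := h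
    exact ⟨g⁻¹, inv_mem hg, e.inv⟩

theorem exists_mem_mobiusGroup_isLift {g : (SpacePart N × ℝ) ≃ₗ[ℝ] (SpacePart N × ℝ)}
    (hg : g ∈ lorentzReflectionGroup (SpacePart N)) : ∃ f ∈ mobiusGroup N, IsLift f g := by
  induction hg using Subgroup.closure_induction with
  | mem g hg =>
    obtain ⟨u, hu, rfl⟩ := hg
    obtain ⟨σ, hσ, h⟩ := exists_isInversion_isLift u hu
    exact ⟨σ, Subgroup.subset_closure hσ, h⟩
  | one => exact ⟨1, one_mem _, isLift_one⟩
  | mul g g' _ _ h h' =>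
    obtain ⟨f, hf, e⟩ := h
    obtain ⟨f', hf', e'⟩ := h'
    exact ⟨f * f', mul_mem hf hf', e.mul e'⟩
  | inv g _ h =>
    obtain ⟨f, hf, e⟩ := h
    exact ⟨f⁻¹, inv_mem hf, e.inv⟩

/-- The set of points on the positive side of a vector of the Lorentz space. -/
def positiveSide (v : SpacePart N × ℝ) : Set (ExtSpace N) :=
  {x | 0 < lorentzForm _ v (pointVec x)}

/-- Positivity of the factors in `IsLift` is essential: a negative factor would exchange the two
sides. -/
theorem IsLift.image_positiveSide {f : Equiv.Perm (ExtSpace N)} {g} (h : IsLift f g)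
    (hg : g ∈ lorentzReflectionGroup (SpacePart N)) (v : SpacePart N × ℝ) :
    f '' positiveSide v = positiveSide (g v) := by
  ext y
  obtain ⟨x, rfl⟩ := f.surjective y
  obtain ⟨r, hr, e⟩ := h x
  rw [f.injective.mem_set_image]
  simp only [positiveSide, Set.mem_ofPred_eq]
  rw [e, map_smul, lorentzForm_map hg, smul_eq_mul, mul_pos_iff_of_pos_left hr]

end Lift

/-! ### Open balls as positive sides of unit vectors -/

section Balls

variable {N : ℕ}

open Filter Topology

theorem tendsto_inv_one_add_norm_sq :
    Tendsto (fun y : EuclideanSpace ℝ (Fin N) => (1 + ‖y‖ ^ 2)⁻¹) (cocompact _) (𝓝 0) :=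
  tendsto_inv_atTop_zero.comp <| tendsto_atTop_add_const_left _ _ <|
    (tendsto_pow_atTop two_ne_zero).comp (tendsto_norm_cocompact_atTop (E := EuclideanSpace ℝ (Fin N)))

theorem tendsto_inner_div_one_add_norm_sq (b : EuclideanSpace ℝ (Fin N)) :
    Tendsto (fun y : EuclideanSpace ℝ (Fin N) => inner ℝ b y * (1 + ‖y‖ ^ 2)⁻¹) (cocompact _)
      (𝓝 0) := by
  have h1 : Tendsto (fun y : EuclideanSpace ℝ (Fin N) => ‖b‖ * ‖y‖⁻¹) (cocompact _) (𝓝 0) := by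
    simpa using (tendsto_inv_atTop_zero.comp
      (tendsto_norm_cocompact_atTop (E := EuclideanSpace ℝ (Fin N)))).const_mul ‖b‖
  refine squeeze_zero_norm (fun y => ?_) h1
  have h2 : 0 < 1 + ‖y‖ ^ 2 := by positivity
  rw [norm_mul, norm_inv, Real.norm_of_nonneg h2.le]
  calc ‖inner ℝ b y‖ * (1 + ‖y‖ ^ 2)⁻¹ ≤ ‖b‖ * ‖y‖ * (1 + ‖y‖ ^ 2)⁻¹ := by
        gcongr
        exact norm_inner_le_norm b y
    _ = ‖b‖ * (‖y‖ * (1 + ‖y‖ ^ 2)⁻¹) := mul_assoc _ _ _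
    _ ≤ ‖b‖ * ‖y‖⁻¹ := by
        gcongr
        by_cases hy : ‖y‖ = 0
        · simp [hy]
        · field_simp
          linarith

/-- Dividing by `1 + ‖y‖ ^ 2`, twice the time coordinate of `pointVec y`, gives a function
continuous at `∞` without changing signs. -/
theorem exists_continuous_sign_eq (v : SpacePart N × ℝ) :
    ∃ G : ExtSpace N → ℝ, Continuous G ∧
      ∀ x, ∃ r : ℝ, 0 < r ∧ G x = r * lorentzForm _ v (pointVec x) := by
  obtain ⟨b, a, c, rfl⟩ := exists_eq_quadricVec v
  refine ⟨fun x => (x.elim 1 fun y => (1 + ‖y‖ ^ 2)⁻¹) *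
    lorentzForm _ (quadricVec b a c) (pointVec x), ?_, fun x => ⟨_, ?_, rfl⟩⟩
  · rw [OnePoint.continuous_iff, coclosedCompact_eq_cocompact]
    simp only [OnePoint.elim_some, OnePoint.elim_infty, lorentzForm_pointVec_coe,
      lorentzForm_pointVec_infty]
    constructor
    · have h := ((tendsto_inner_div_one_add_norm_sq b).add
        (tendsto_inv_one_add_norm_sq.const_mul ((a - c) / 2))).add_const (-a / 2)
      have e : (0 : ℝ) + (a - c) / 2 * 0 + -a / 2 = 1 * (-a / 2) := by ring
      rw [e] at h
      refine h.congr fun y => ?_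
      have h2 : 1 + ‖y‖ ^ 2 ≠ 0 := by positivity
      field_simp
      ring
    · have h2 : ∀ y : EuclideanSpace ℝ (Fin N), 1 + ‖y‖ ^ 2 ≠ 0 := fun y => by positivity
      fun_prop (disch := exact h2 _)
  · induction x using OnePoint.rec with
    | infty => exact one_pos
    | coe y =>
      change 0 < (1 + ‖y‖ ^ 2)⁻¹
      positivity

theorem isOpen_positiveSide (v : SpacePart N × ℝ) : IsOpen (positiveSide v) := by
  obtain ⟨G, hG, h⟩ := exists_continuous_sign_eq v
  have : positiveSide v = G ⁻¹' Set.Ioi 0 := by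
    ext x
    obtain ⟨r, hr, e⟩ := h x
    simp only [positiveSide, Set.mem_ofPred_eq, Set.mem_preimage, Set.mem_Ioi, e,
      mul_pos_iff_of_pos_left hr]
  rw [this]
  exact isOpen_Ioi.preimage hG

theorem mem_positiveSide_neg {v : SpacePart N × ℝ} {x : ExtSpace N} :
    x ∈ positiveSide (-v) ↔ lorentzForm _ v (pointVec x) < 0 := by
  simp only [positiveSide, Set.mem_ofPred_eq, map_neg, LinearMap.neg_apply, Left.neg_pos_iff]

theorem disjoint_positiveSide_neg (v : SpacePart N × ℝ) :
    Disjoint (positiveSide v) (positiveSide (-v)) :=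
  Set.disjoint_left.2 fun _ h h' => lt_asymm (mem_positiveSide_neg.1 h') h

theorem tendsto_coe_smul_atTop {b : EuclideanSpace ℝ (Fin N)} (hb : b ≠ 0)
    (c : EuclideanSpace ℝ (Fin N)) :
    Tendsto (fun s : ℝ => ((c + s • b : EuclideanSpace ℝ (Fin N)) : ExtSpace N)) atTop
      (𝓝 (∞ : ExtSpace N)) := by
  have h1 : Tendsto (fun s : ℝ => c + s • b) atTop (cocompact _) := by
    rw [← Metric.cobounded_eq_cocompact, ← tendsto_norm_atTop_iff_cobounded]
    have h2 : Tendsto (fun s : ℝ => s * ‖b‖ - ‖c‖) atTop atTop :=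
      tendsto_atTop_add_const_right _ _ (tendsto_id.atTop_mul_const (norm_pos_iff.2 hb))
    refine tendsto_atTop_mono (fun s => ?_) h2
    have h3 := norm_sub_norm_le (s • b) (-c)
    rw [norm_smul, norm_neg, sub_neg_eq_add, add_comm (s • b)] at h3
    have h4 := mul_le_mul_of_nonneg_right (le_abs_self s) (norm_nonneg b)
    rw [Real.norm_eq_abs] at h3
    linarith
  rw [← coclosedCompact_eq_cocompact] at h1
  exact OnePoint.tendsto_coe_infty.comp h1

theorem mem_closure_positiveSide {v : SpacePart N × ℝ} (hv : lorentzForm _ v v = 1)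
    {x : ExtSpace N} (hx : lorentzForm _ v (pointVec x) = 0) : x ∈ closure (positiveSide v) := by
  obtain ⟨b, a, c, rfl⟩ := exists_eq_quadricVec v
  rw [lorentzForm_quadricVec, real_inner_self_eq_norm_sq] at hv
  induction x using OnePoint.rec with
  | infty =>
    rw [lorentzForm_pointVec_infty] at hx
    obtain rfl : a = 0 := by linarith
    have hb : b ≠ 0 := by
      rintro rfl
      simp at hv
    refine mem_closure_of_tendsto (tendsto_coe_smul_atTop hb 0) ?_
    filter_upwards [eventually_gt_atTop (c / 2)] with s hs
    simp only [positiveSide, Set.mem_ofPred_eq]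
    rw [lorentzForm_pointVec_coe, zero_add, real_inner_smul_right, real_inner_self_eq_norm_sq,
      show ‖b‖ ^ 2 = 1 by linarith]
    linarith
  | coe y =>
    rw [lorentzForm_pointVec_coe] at hx
    -- `b - a • y` is the gradient at `y` of the defining quadratic, a unit vector on the zero set;
    -- a short step along it enters the positive side.
    have hd : ‖b - a • y‖ ^ 2 = 1 := by
      rw [norm_sub_sq_real, norm_smul, mul_pow, Real.norm_eq_abs, sq_abs, real_inner_smul_right]
      linear_combination hv - 2 * a * hx
    have hc : Continuous (fun s : ℝ =>
        ((y + s • (b - a • y) : EuclideanSpace ℝ (Fin N)) : ExtSpace N)) :=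
      OnePoint.continuous_coe.comp (by fun_prop)
    have ht : Tendsto (fun s : ℝ =>
        ((y + s • (b - a • y) : EuclideanSpace ℝ (Fin N)) : ExtSpace N)) (𝓝[>] 0)
        (𝓝 (y : ExtSpace N)) := by
      have := (hc.tendsto 0).mono_left (nhdsWithin_le_nhds (s := Set.Ioi 0))
      simpa using this
    refine mem_closure_of_tendsto ht ?_
    have hI : Set.Ioo (0 : ℝ) (1 / (1 + |a|)) ∈ 𝓝[>] (0 : ℝ) :=
      Ioo_mem_nhdsGT (by positivity)
    filter_upwards [hI] with s hs
    simp only [positiveSide, Set.mem_ofPred_eq]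
    have e : lorentzForm _ (quadricVec b a c)
        (pointVec ((y + s • (b - a • y) : EuclideanSpace ℝ (Fin N)) : ExtSpace N)) =
        s - a * s ^ 2 / 2 := by
      have h3 : inner ℝ b (b - a • y) - a * inner ℝ y (b - a • y) = 1 := by
        rw [← hd, ← real_inner_self_eq_norm_sq (b - a • y), inner_sub_left (b) (a • y),
          real_inner_smul_left]
      rw [lorentzForm_pointVec_coe, norm_add_sq_real, norm_smul, mul_pow, hd, Real.norm_eq_abs,
        sq_abs, inner_add_right, real_inner_smul_right, real_inner_smul_right]
      linear_combination hx + s * h3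
    rw [e]
    have h4 : s * (1 + |a|) < 1 := by
      have := hs.2
      rwa [lt_div_iff₀ (by positivity)] at this
    have h5 : a * s ≤ |a| * s := mul_le_mul_of_nonneg_right (le_abs_self a) hs.1.le
    have h6 : 0 < s * (1 - a * s / 2) := mul_pos hs.1 (by nlinarith [hs.1])
    linarith

theorem frontier_positiveSide {v : SpacePart N × ℝ} (hv : lorentzForm _ v v = 1) :
    frontier (positiveSide v) = {x | lorentzForm _ v (pointVec x) = 0} := by
  rw [(isOpen_positiveSide v).frontier_eq]
  ext x
  simp only [Set.mem_sdiff, Set.mem_ofPred_eq]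
  constructor
  · rintro ⟨h, h'⟩
    refine le_antisymm (not_lt.1 h') (not_lt.1 fun hneg => ?_)
    exact ((disjoint_positiveSide_neg v).closure_left (isOpen_positiveSide _)).le_bot
      ⟨h, mem_positiveSide_neg.2 hneg⟩
  · intro h
    exact ⟨mem_closure_positiveSide hv h, fun h' => h'.ne' h⟩

theorem hat_positiveSide {v : SpacePart N × ℝ} (hv : lorentzForm _ v v = 1) :
    hat (positiveSide v) = positiveSide (-v) := by
  ext x
  rw [hat, frontier_positiveSide hv, mem_positiveSide_neg]
  simp only [positiveSide, Set.mem_compl_iff, Set.mem_union, Set.mem_ofPred_eq, not_or]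
  constructor
  · rintro ⟨h, h'⟩
    exact (not_lt.1 h).lt_of_ne h'
  · exact fun h => ⟨h.not_gt, h.ne⟩

theorem positiveSide_sphereVec_inv (c : EuclideanSpace ℝ (Fin N)) {r : ℝ} (hr : 0 < r) :
    positiveSide (sphereVec c r⁻¹) = euclideanBall c r := by
  ext x
  induction x using OnePoint.rec with
  | infty =>
    simp only [positiveSide, euclideanBall, Set.mem_ofPred_eq]
    rw [sphereVec, lorentzForm_pointVec_infty]
    simp only [OnePoint.infty_notMem_image_coe, iff_false, not_lt]
    have := inv_pos.2 hr
    linarith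
  | coe y =>
    rw [euclideanBall, OnePoint.coe_injective.mem_set_image, Metric.mem_ball]
    simp only [positiveSide, Set.mem_ofPred_eq]
    rw [lorentzForm_sphereVec_pointVec]
    have : (1 / r⁻¹ - r⁻¹ * dist y c ^ 2) / 2 = (r ^ 2 - dist y c ^ 2) / (2 * r) := by
      field_simp
    rw [this, div_pos_iff_of_pos_right (by positivity), sub_pos]
    exact sq_lt_sq₀ dist_nonneg hr.le

theorem isPreconnected_positiveSide {v : SpacePart N × ℝ} (hv : lorentzForm _ v v = 1) :
    IsPreconnected (positiveSide v) := by
  rcases exists_sphereVec_or_plane hv with ⟨c, a, ha, rfl⟩ | ⟨b, k, hb, rfl⟩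
  · rcases ha.lt_or_gt with ha | ha
    -- Negative `a` is the exterior: each finite point is joined to `∞` by the ray pointing away
    -- from the centre.
    · refine isPreconnected_of_forall (∞ : ExtSpace N) fun y hy => ?_
      have hinf : (∞ : ExtSpace N) ∈ positiveSide (sphereVec c a) := by
        simp only [positiveSide, Set.mem_ofPred_eq]
        rw [sphereVec, lorentzForm_pointVec_infty]
        linarith
      induction y using OnePoint.rec with
      | infty => exact ⟨{∞}, by simpa using hinf, rfl, rfl, isPreconnected_singleton⟩
      | coe y =>
        have hy' : 0 < (1 / a - a * dist y c ^ 2) / 2 := by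
          rw [← lorentzForm_sphereVec_pointVec]; exact hy
        have hyc : y - c ≠ 0 := by
          intro h
          rw [dist_eq_norm, h, norm_zero] at hy'
          have := one_div_neg.2 ha
          linarith
        let ρ : ℝ → ExtSpace N := fun s => ((c + s • (y - c) : EuclideanSpace ℝ (Fin N)) : ExtSpace N)
        have hρ : Continuous ρ := OnePoint.continuous_coe.comp (by fun_prop)
        have hcon : IsPreconnected (ρ '' Set.Ici 1) := isPreconnected_Ici.image _ hρ.continuousOn
        refine ⟨insert ∞ (ρ '' Set.Ici 1), ?_, Set.mem_insert _ _, Set.mem_insert_of_mem _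
          ⟨1, Set.self_mem_Ici, by simp [ρ]⟩, hcon.subset_closure (Set.subset_insert _ _) ?_⟩
        · rintro _ (rfl | ⟨s, hs, rfl⟩)
          · exact hinf
          · have hs : 1 ≤ s := hs
            simp only [positiveSide, Set.mem_ofPred_eq, ρ]
            rw [lorentzForm_sphereVec_pointVec, dist_eq_norm, add_sub_cancel_left, norm_smul,
              mul_pow, Real.norm_eq_abs, sq_abs, ← dist_eq_norm]
            have h1 : 1 ≤ s ^ 2 := one_le_pow₀ hs
            nlinarith [mul_nonneg (mul_nonneg (neg_nonneg.2 ha.le) (sq_nonneg (dist y c)))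
              (sub_nonneg.2 h1)]
        · refine Set.insert_subset ?_ subset_closure
          refine mem_closure_of_tendsto (tendsto_coe_smul_atTop hyc c) ?_
          filter_upwards [eventually_ge_atTop 1] with s hs
          exact ⟨s, hs, rfl⟩
    · have := positiveSide_sphereVec_inv c (inv_pos.2 ha)
      rw [inv_inv] at this
      rw [this]
      exact (convex_ball c _).isPreconnected.image _ OnePoint.continuous_coe.continuousOn
  · have : positiveSide (quadricVec b 0 k) =
        (fun x : EuclideanSpace ℝ (Fin N) => (x : ExtSpace N)) '' {y | k / 2 < inner ℝ b y} := by
      ext x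
      induction x using OnePoint.rec with
      | infty =>
        simp only [positiveSide, Set.mem_ofPred_eq]
        rw [lorentzForm_pointVec_infty]
        simp
      | coe y =>
        rw [OnePoint.coe_injective.mem_set_image]
        simp only [positiveSide, Set.mem_ofPred_eq]
        rw [lorentzForm_pointVec_coe, zero_mul, zero_add, sub_pos]
    rw [this]
    exact (convex_halfSpace_gt (innerₗ _ b).isLinear _).isPreconnected.image _
      OnePoint.continuous_coe.continuousOn

theorem IsSphere.exists_eq_zeroSet {S : Set (ExtSpace N)} (hS : IsSphere S) :
    ∃ v, lorentzForm _ v v = 1 ∧ S = {x | lorentzForm (SpacePart N) v (pointVec x) = 0} := by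
  rcases hS with ⟨c, r, hr, rfl⟩ | ⟨p, n, hn, rfl⟩
  · refine ⟨sphereVec c r⁻¹, lorentzForm_sphereVec_self c (inv_ne_zero hr.ne'), ?_⟩
    ext x
    induction x using OnePoint.rec with
    | infty =>
      simp only [Set.mem_ofPred_eq]
      rw [sphereVec, lorentzForm_pointVec_infty]
      simp [hr.ne']
    | coe y =>
      rw [OnePoint.coe_injective.mem_set_image, Metric.mem_sphere, Set.mem_ofPred_eq,
        lorentzForm_sphereVec_pointVec, ← sq_eq_sq₀ dist_nonneg hr.le]
      have : (1 / r⁻¹ - r⁻¹ * dist y c ^ 2) / 2 = (r ^ 2 - dist y c ^ 2) / (2 * r) := by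
        field_simp
      rw [this, div_eq_zero_iff, or_iff_left (by positivity), sub_eq_zero, eq_comm]
  · have hn0 : ‖n‖ ≠ 0 := norm_ne_zero_iff.2 hn
    refine ⟨quadricVec (‖n‖⁻¹ • n) 0 (2 * inner ℝ (‖n‖⁻¹ • n) p), ?_, ?_⟩
    · rw [lorentzForm_quadricVec, real_inner_self_eq_norm_sq, norm_smul, norm_inv, norm_norm,
        inv_mul_cancel₀ hn0]
      norm_num
    ext x
    induction x using OnePoint.rec with
    | infty =>
      simp only [Set.mem_ofPred_eq]
      rw [lorentzForm_pointVec_infty]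
      simp
    | coe y =>
      rw [Set.mem_insert_iff, or_iff_right (OnePoint.coe_ne_infty _),
        OnePoint.coe_injective.mem_set_image, SetLike.mem_coe, AffineSubspace.mem_mk',
        Submodule.mem_orthogonal_singleton_iff_inner_right, Set.mem_ofPred_eq,
        lorentzForm_pointVec_coe, vsub_eq_sub, inner_sub_right, real_inner_smul_left,
        real_inner_smul_left]
      have : ‖n‖⁻¹ * inner ℝ n y - (0 * ‖y‖ ^ 2 + 2 * (‖n‖⁻¹ * inner ℝ n p)) / 2 =
        ‖n‖⁻¹ * (inner ℝ n y - inner ℝ n p) := by ring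
      rw [this, mul_eq_zero, or_iff_right (inv_ne_zero hn0)]

/-- The complement of the sphere is the disjoint union of two open connected sides, so these are its
components. -/
theorem IsOpenBall.exists_eq_positiveSide {B : Set (ExtSpace N)} (hB : IsOpenBall B) :
    ∃ v, lorentzForm (SpacePart N) v v = 1 ∧ B = positiveSide v := by
  obtain ⟨S, hS, x, hx, rfl⟩ := hB
  obtain ⟨v, hv, rfl⟩ := hS.exists_eq_zeroSet
  suffices h : ∀ w : SpacePart N × ℝ, lorentzForm _ w w = 1 → x ∈ positiveSide w →
      {x | lorentzForm (SpacePart N) v (pointVec x) = 0}ᶜ = positiveSide w ∪ positiveSide (-w) →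
      connectedComponentIn {x | lorentzForm (SpacePart N) v (pointVec x) = 0}ᶜ x =
        positiveSide w by
    have hc : {x | lorentzForm (SpacePart N) v (pointVec x) = 0}ᶜ =
        positiveSide v ∪ positiveSide (-v) := by
      ext y
      rw [Set.mem_union, mem_positiveSide_neg]
      simp only [positiveSide, Set.mem_compl_iff, Set.mem_ofPred_eq]
      rw [← ne_eq, ne_iff_lt_or_gt, or_comm]
    rcases (hc ▸ hx : x ∈ positiveSide v ∪ positiveSide (-v)) with hx' | hx'
    · exact ⟨v, hv, h v hv hx' hc⟩
    · have hv' : lorentzForm _ (-v) (-v) = 1 := by simpa using hv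
      exact ⟨-v, hv', h (-v) hv' hx' (by rw [neg_neg, Set.union_comm, hc])⟩
  intro w hw hxw hc
  refine Set.Subset.antisymm ?_ ?_
  · refine isPreconnected_connectedComponentIn.subset_left_of_subset_union
      (isOpen_positiveSide w) (isOpen_positiveSide (-w)) (disjoint_positiveSide_neg w) ?_
      ⟨x, mem_connectedComponentIn hx, hxw⟩
    rw [← hc]
    exact connectedComponentIn_subset _ _
  · refine (isPreconnected_positiveSide hw).subset_connectedComponentIn hxw ?_
    rw [hc]
    exact Set.subset_union_left

end Balls

/-! ### The signed inversive distance as a Lorentz product -/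

section Distance

variable {N : ℕ}

/-- A sphere determines its vector up to scale. Positive dimension is needed for the sphere to have
enough points. -/
theorem exists_eq_smul_of_zeroSet_subset [Nontrivial (EuclideanSpace ℝ (Fin N))]
    {v w : SpacePart N × ℝ} (hv : lorentzForm _ v v = 1)
    (h : ∀ x : ExtSpace N, lorentzForm _ v (pointVec x) = 0 → lorentzForm _ w (pointVec x) = 0) :
    ∃ κ : ℝ, w = κ • v := by
  obtain ⟨b', a', c', rfl⟩ := exists_eq_quadricVec w
  rcases exists_sphereVec_or_plane hv with ⟨c, a, ha, rfl⟩ | ⟨b, k, hb, rfl⟩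
  · have hz : ∀ e : EuclideanSpace ℝ (Fin N), ‖e‖ = 1 →
        inner ℝ b' c + a⁻¹ * inner ℝ b' e -
          (a' * (‖c‖ ^ 2 + 2 * a⁻¹ * inner ℝ c e + (a ^ 2)⁻¹) + c') / 2 = 0 := by
      intro e he
      have h1 := h ((c + a⁻¹ • e : EuclideanSpace ℝ (Fin N)) : ExtSpace N) (by
        rw [lorentzForm_sphereVec_pointVec, dist_eq_norm, add_sub_cancel_left, norm_smul, mul_pow,
          Real.norm_eq_abs, sq_abs, he]
        field_simp
        ring)
      rw [lorentzForm_pointVec_coe, norm_add_sq_real, norm_smul, mul_pow, Real.norm_eq_abs, sq_abs,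
        he, inner_add_right, real_inner_smul_right, real_inner_smul_right, inv_pow] at h1
      linear_combination h1
    -- Subtracting the equations at the antipodal points `c ± a⁻¹ • e` isolates the part linear in
    -- `e`.
    have hdiff : ∀ e : EuclideanSpace ℝ (Fin N), ‖e‖ = 1 → inner ℝ (b' - a' • c) e = 0 := by
      intro e he
      have h1 := hz e he
      have h2 := hz (-e) (by rwa [norm_neg])
      rw [inner_neg_right, inner_neg_right] at h2
      rw [inner_sub_left, real_inner_smul_left]
      have h3 : a⁻¹ * (inner ℝ b' e - a' * inner ℝ c e) = 0 := by
        linear_combination (h1 - h2) / 2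
      exact (mul_eq_zero.1 h3).resolve_left (inv_ne_zero ha)
    have hb : b' = a' • c := by
      by_contra hne
      have hne' := sub_ne_zero.2 hne
      have h1 := hdiff (‖b' - a' • c‖⁻¹ • (b' - a' • c)) (by
        rw [norm_smul, norm_inv, norm_norm, inv_mul_cancel₀ (norm_ne_zero_iff.2 hne')])
      rw [real_inner_smul_right, real_inner_self_eq_norm_sq] at h1
      have := norm_ne_zero_iff.2 hne'
      field_simp at h1
      exact this h1
    obtain ⟨e, he⟩ := exists_norm_eq (EuclideanSpace ℝ (Fin N)) zero_le_one
    have h1 := hz e he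
    rw [hb, real_inner_smul_left, real_inner_smul_left, real_inner_self_eq_norm_sq] at h1
    refine ⟨a' / a, ?_⟩
    rw [sphereVec, smul_quadricVec, smul_smul, div_mul_cancel₀ _ ha, hb]
    congr 1
    field_simp at h1 ⊢
    linear_combination -h1
  · obtain rfl : a' = 0 := by
      have := h ∞ (by rw [lorentzForm_pointVec_infty]; norm_num)
      rw [lorentzForm_pointVec_infty] at this
      linarith
    have hz : ∀ z : EuclideanSpace ℝ (Fin N), inner ℝ b z = 0 →
        k * inner ℝ b' b + 2 * inner ℝ b' z = c' := by
      intro z hz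
      have h1 := h (((k / 2) • b + z : EuclideanSpace ℝ (Fin N)) : ExtSpace N) (by
        rw [lorentzForm_pointVec_coe, inner_add_right, hz, real_inner_smul_right,
          real_inner_self_eq_norm_sq, hb]
        ring)
      rw [lorentzForm_pointVec_coe, inner_add_right, real_inner_smul_right] at h1
      linear_combination 2 * h1
    have h0 := hz 0 (inner_zero_right _)
    rw [inner_zero_right, mul_zero, add_zero] at h0
    -- Test with the part of `b'` tangent to the plane, which must then vanish.
    have horth : inner ℝ b (b' - inner ℝ b' b • b) = 0 := by
      rw [inner_sub_right, real_inner_smul_right, real_inner_self_eq_norm_sq, hb,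
        real_inner_comm]
      ring
    have h1 := hz _ horth
    have h2 : inner ℝ (b' - inner ℝ b' b • b) (b' - inner ℝ b' b • b) = 0 := by
      rw [inner_sub_left, real_inner_smul_left, horth]
      linarith
    have h3 : b' = inner ℝ b' b • b := sub_eq_zero.1 (inner_self_eq_zero.1 h2)
    refine ⟨inner ℝ b' b, ?_⟩
    rw [smul_quadricVec, ← h3, mul_zero, ← h0, mul_comm]

theorem positiveSide_injective [Nontrivial (EuclideanSpace ℝ (Fin N))]
    {v w : SpacePart N × ℝ} (hv : lorentzForm _ v v = 1) (hw : lorentzForm _ w w = 1)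
    (h : positiveSide v = positiveSide w) : v = w := by
  have hf : ∀ x : ExtSpace N, lorentzForm _ v (pointVec x) = 0 ↔
      lorentzForm _ w (pointVec x) = 0 := by
    have := congrArg frontier h
    rw [frontier_positiveSide hv, frontier_positiveSide hw] at this
    exact fun x => Set.ext_iff.1 this x
  obtain ⟨κ, rfl⟩ := exists_eq_smul_of_zeroSet_subset hv fun x => (hf x).1
  simp only [map_smul, LinearMap.smul_apply, smul_eq_mul, hv, mul_one] at hw
  rcases mul_self_eq_one_iff.1 hw with rfl | rfl
  · rw [one_smul]
  · rw [neg_one_smul] at h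
    -- If `w = -v`, both sides are empty, so every point is on the zero set and hence in the closure
    -- of an empty side.
    have he : positiveSide v = ∅ := by
      have := disjoint_positiveSide_neg v
      rwa [← h, disjoint_self] at this
    have h0 : (∞ : ExtSpace N) ∈ closure (positiveSide v) := by
      refine mem_closure_positiveSide hv (le_antisymm (not_lt.1 fun hlt => ?_)
        (not_lt.1 fun hlt => ?_))
      · exact (he ▸ hlt : (∞ : ExtSpace N) ∈ (∅ : Set _))
      · rw [← mem_positiveSide_neg, ← h, he] at hlt
        exact hlt
    rw [he, closure_empty] at h0
    exact h0.elim

theorem IsSideOfEuclideanSphere.eq_positiveSide {B : Set (ExtSpace N)}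
    {c : EuclideanSpace ℝ (Fin N)} {r ε : ℝ} (hr : 0 < r) (h : IsSideOfEuclideanSphere B c r ε) :
    (ε = 1 ∨ ε = -1) ∧ B = positiveSide (sphereVec c (ε / r)) := by
  rcases h with ⟨rfl, rfl⟩ | ⟨rfl, rfl⟩
  · exact ⟨Or.inl rfl, by rw [one_div, positiveSide_sphereVec_inv c hr]⟩
  · refine ⟨Or.inr rfl, ?_⟩
    rw [neg_div, one_div, ← neg_sphereVec, ← positiveSide_sphereVec_inv c hr,
      hat_positiveSide (lorentzForm_sphereVec_self c (inv_ne_zero hr.ne'))]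

theorem exists_isSideOfEuclideanSphere (c : EuclideanSpace ℝ (Fin N)) {a : ℝ} (ha : a ≠ 0) :
    ∃ r ε : ℝ, 0 < r ∧ IsSideOfEuclideanSphere (positiveSide (sphereVec c a)) c r ε ∧
      a = ε / r := by
  have hr : 0 < |a|⁻¹ := inv_pos.2 (abs_pos.2 ha)
  have h := positiveSide_sphereVec_inv c hr
  rw [inv_inv] at h
  rcases ha.lt_or_gt with h0 | h0
  · rw [abs_of_neg h0] at h hr
    refine ⟨(-a)⁻¹, -1, hr, Or.inr ⟨rfl, ?_⟩, ?_⟩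
    · rw [← h, hat_positiveSide (lorentzForm_sphereVec_self c (neg_ne_zero.2 ha)), neg_sphereVec,
        neg_neg]
    · rw [div_inv_eq_mul, neg_one_mul, neg_neg]
  · rw [abs_of_pos h0] at h hr
    exact ⟨a⁻¹, 1, hr, Or.inl ⟨rfl, h⟩, by rw [div_inv_eq_mul, one_mul]⟩

theorem lorentzForm_sphereVec_div (c c' : EuclideanSpace ℝ (Fin N)) {r r' ε ε' : ℝ} (hr : 0 < r)
    (hr' : 0 < r') (hε : ε = 1 ∨ ε = -1) (hε' : ε' = 1 ∨ ε' = -1) :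
    lorentzForm _ (sphereVec c (ε / r)) (sphereVec c' (ε' / r')) =
      ε * ε' * ((r ^ 2 + r' ^ 2 - dist c c' ^ 2) / (2 * r * r')) := by
  rw [lorentzForm_sphereVec]
  rcases hε with rfl | rfl <;> rcases hε' with rfl | rfl <;> field_simp <;> ring

theorem HasSignedInversiveDist.eq_lorentzForm [Nontrivial (EuclideanSpace ℝ (Fin N))]
    {v w : SpacePart N × ℝ} (hv : lorentzForm _ v v = 1) (hw : lorentzForm _ w w = 1) {d : ℝ}
    (h : HasSignedInversiveDist (positiveSide v) (positiveSide w) d) :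
    d = lorentzForm _ v w := by
  obtain ⟨f, hf, c₁, c₂, r₁, r₂, ε₁, ε₂, hr₁, hr₂, h₁, h₂, rfl⟩ := h
  obtain ⟨g, hg, hfg⟩ := exists_isLift_of_mem_mobiusGroup hf
  rw [hfg.image_positiveSide hg] at h₁ h₂
  obtain ⟨hε₁, h₁⟩ := h₁.eq_positiveSide hr₁
  obtain ⟨hε₂, h₂⟩ := h₂.eq_positiveSide hr₂
  have hne : ∀ {ε r : ℝ}, 0 < r → (ε = 1 ∨ ε = -1) → ε / r ≠ 0 := by
    rintro ε r hr (rfl | rfl)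
    · exact div_ne_zero one_ne_zero hr.ne'
    · exact div_ne_zero (neg_ne_zero.2 one_ne_zero) hr.ne'
  have e₁ := positiveSide_injective (by rwa [lorentzForm_map hg])
    (lorentzForm_sphereVec_self c₁ (hne hr₁ hε₁)) h₁
  have e₂ := positiveSide_injective (by rwa [lorentzForm_map hg])
    (lorentzForm_sphereVec_self c₂ (hne hr₂ hε₂)) h₂
  rw [← lorentzForm_map hg, e₁, e₂, lorentzForm_sphereVec_div c₁ c₂ hr₁ hr₂ hε₁ hε₂]

theorem isOpen_dense_ne_zero {v : SpacePart N × ℝ} (hv : lorentzForm _ v v = 1) :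
    IsOpen {x : ExtSpace N | lorentzForm _ v (pointVec x) ≠ 0} ∧
      Dense {x : ExtSpace N | lorentzForm _ v (pointVec x) ≠ 0} := by
  constructor
  · have := (frontier_positiveSide hv ▸ isClosed_frontier (s := positiveSide v)).isOpen_compl
    exact this
  · intro x
    by_cases h : lorentzForm _ v (pointVec x) = 0
    · exact closure_mono (fun y hy => ne_of_gt (show 0 < lorentzForm _ v (pointVec y) from hy)) (mem_closure_positiveSide hv h)
    · exact subset_closure h

theorem exists_coe_not_mem_frontier [Nontrivial (EuclideanSpace ℝ (Fin N))]
    {v w : SpacePart N × ℝ} (hv : lorentzForm _ v v = 1) (hw : lorentzForm _ w w = 1) :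
    ∃ y : EuclideanSpace ℝ (Fin N), lorentzForm _ v (pointVec (y : ExtSpace N)) ≠ 0 ∧
      lorentzForm _ w (pointVec (y : ExtSpace N)) ≠ 0 := by
  have : NoncompactSpace (EuclideanSpace ℝ (Fin N)) := NormedSpace.noncompactSpace ℝ _
  obtain ⟨hov, hdv⟩ := isOpen_dense_ne_zero hv
  obtain ⟨how, hdw⟩ := isOpen_dense_ne_zero hw
  obtain ⟨y, hy⟩ := OnePoint.denseRange_coe.exists_mem_open (hov.inter how)
    (hdv.inter_of_isOpen_left hdw hov).nonempty
  exact ⟨y, hy⟩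

theorem hasSignedInversiveDist_positiveSide [Nontrivial (EuclideanSpace ℝ (Fin N))]
    {v w : SpacePart N × ℝ} (hv : lorentzForm _ v v = 1) (hw : lorentzForm _ w w = 1) :
    HasSignedInversiveDist (positiveSide v) (positiveSide w) (lorentzForm _ v w) := by
  -- Inversion about a point off both spheres sends that point to `∞`, so neither image passes
  -- through `∞` and both are Euclidean spheres.
  obtain ⟨y, hvy, hwy⟩ := exists_coe_not_mem_frontier hv hw
  have hf : sphereInversion y 1 one_pos ∈ mobiusGroup N :=
    Subgroup.subset_closure (Or.inl ⟨y, 1, one_pos, rfl⟩)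
  obtain ⟨g, hg, hfg⟩ := exists_isLift_of_mem_mobiusGroup hf
  have key : ∀ u : SpacePart N × ℝ, lorentzForm _ u u = 1 →
      lorentzForm _ u (pointVec (y : ExtSpace N)) ≠ 0 → ∃ c a, a ≠ 0 ∧ g u = sphereVec c a := by
    intro u hu huy
    rcases exists_sphereVec_or_plane (v := g u) (by rwa [lorentzForm_map hg]) with h | ⟨b, k, -, h⟩
    · exact h
    · exfalso
      obtain ⟨r, hr, e⟩ := hfg (y : ExtSpace N)
      have hy : sphereInversion y 1 one_pos (y : ExtSpace N) = ∞ := by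
        simp [sphereInversion, sphereInversionFun]
      have h1 := lorentzForm_pointVec_infty b 0 k
      rw [← h, ← hy, e, map_smul, lorentzForm_map hg, smul_eq_mul, neg_zero, zero_div] at h1
      exact (mul_ne_zero hr.ne' huy) h1
  obtain ⟨c₁, a₁, ha₁, e₁⟩ := key v hv hvy
  obtain ⟨c₂, a₂, ha₂, e₂⟩ := key w hw hwy
  obtain ⟨r₁, ε₁, hr₁, h₁, rfl⟩ := exists_isSideOfEuclideanSphere c₁ ha₁
  obtain ⟨r₂, ε₂, hr₂, h₂, rfl⟩ := exists_isSideOfEuclideanSphere c₂ ha₂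
  refine ⟨_, hf, c₁, c₂, r₁, r₂, ε₁, ε₂, hr₁, hr₂, ?_, ?_, ?_⟩
  · rwa [hfg.image_positiveSide hg, e₁]
  · rwa [hfg.image_positiveSide hg, e₂]
  · rw [← lorentzForm_map hg, e₁, e₂, lorentzForm_sphereVec_div c₁ c₂ hr₁ hr₂
      (h₁.eq_positiveSide hr₁).1 (h₂.eq_positiveSide hr₂).1]

theorem signedInversiveDist_positiveSide [Nontrivial (EuclideanSpace ℝ (Fin N))]
    {v w : SpacePart N × ℝ} (hv : lorentzForm _ v v = 1) (hw : lorentzForm _ w w = 1) :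
    signedInversiveDist (positiveSide v) (positiveSide w) = lorentzForm _ v w :=
  (Classical.epsilon_spec (p := HasSignedInversiveDist (positiveSide v) (positiveSide w))
    ⟨_, hasSignedInversiveDist_positiveSide hv hw⟩).eq_lorentzForm hv hw

end Distance

end InversiveGeometry

/-! ### The main theorem -/

theorem theorem1 {N : ℕ} (hN : 1 ≤ N) {A : Type*}
    (B B' : A → Set (InversiveGeometry.ExtSpace N))
    (hB : ∀ α, InversiveGeometry.IsOpenBall (B α))
    (hB' : ∀ α, InversiveGeometry.IsOpenBall (B' α))
    (hempty : (⋂ α, frontier (B α)) = ∅) :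
    (∃ f ∈ InversiveGeometry.mobiusGroup N,
        (∀ α, f '' (B α) = B' α) ∨ (∀ α, f '' (InversiveGeometry.hat (B α)) = B' α)) ↔
      ∀ α β, InversiveGeometry.signedInversiveDist (B α) (B β) =
        InversiveGeometry.signedInversiveDist (B' α) (B' β) := by
  open InversiveGeometry in
  have : Nonempty (Fin N) := ⟨⟨0, hN⟩⟩
  choose v hv hBv using fun α => (hB α).exists_eq_positiveSide
  choose v' hv' hBv' using fun α => (hB' α).exists_eq_positiveSide
  obtain rfl : B = fun α => positiveSide (v α) := funext hBv
  obtain rfl : B' = fun α => positiveSide (v' α) := funext hBv'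
  have hdist : ∀ α β, signedInversiveDist (positiveSide (v α)) (positiveSide (v β)) =
      lorentzForm _ (v α) (v β) := fun α β => signedInversiveDist_positiveSide (hv α) (hv β)
  have hdist' : ∀ α β, signedInversiveDist (positiveSide (v' α)) (positiveSide (v' β)) =
      lorentzForm _ (v' α) (v' β) := fun α β => signedInversiveDist_positiveSide (hv' α) (hv' β)
  simp only [hdist, hdist', hat_positiveSide (hv _)]
  constructor
  · rintro ⟨f, hf, h⟩ α β
    obtain ⟨g, hg, hfg⟩ := exists_isLift_of_mem_mobiusGroup hf
    rcases h with h | h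
    · have e : ∀ α, g (v α) = v' α := fun α => by
        refine positiveSide_injective ?_ (hv' α) ?_
        · rw [lorentzForm_map hg, hv]
        · rw [← h, hfg.image_positiveSide hg]
      rw [← e, ← e, lorentzForm_map hg]
    · have e : ∀ α, g (-v α) = v' α := fun α => by
        refine positiveSide_injective ?_ (hv' α) ?_
        · rw [lorentzForm_map hg, map_neg, map_neg, LinearMap.neg_apply, neg_neg, hv]
        · rw [← h, hfg.image_positiveSide hg]
      rw [← e, ← e, lorentzForm_map hg, map_neg, map_neg, LinearMap.neg_apply, neg_neg]
  · intro h
    -- A nonzero null vector orthogonal to every `v α` is a multiple of some `pointVec x`, and `x`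
    -- then lies on every boundary.
    obtain ⟨g, hg, ε, hε, e⟩ := exists_reflection_of_gram_eq h (fun n hn horth => by
      by_contra h0
      obtain ⟨μ, x, hμ, rfl⟩ := exists_eq_smul_pointVec hn h0
      have hx : x ∈ ⋂ α, frontier (positiveSide (v α)) := by
        refine Set.mem_iInter.2 fun α => ?_
        rw [frontier_positiveSide (hv α), Set.mem_ofPred_eq, lorentzForm_comm]
        have := horth α
        rw [map_smul, LinearMap.smul_apply, smul_eq_mul] at this
        exact (mul_eq_zero.1 this).resolve_left hμ
      rw [hempty] at hx
      exact hx)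
    obtain ⟨f, hf, hfg⟩ := exists_mem_mobiusGroup_isLift hg
    refine ⟨f, hf, ?_⟩
    -- The global sign decides between the balls and their complements.
    rcases hε with rfl | rfl
    · left
      intro α
      rw [hfg.image_positiveSide hg, e, one_smul]
    · right
      intro α
      rw [hfg.image_positiveSide hg, map_neg, e, neg_one_smul, neg_neg]
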